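/- Let $n\ge 1$, let $0\le r_1<\dots<r_n$ be the attacker's rewards, $P(r_1),\dots,P(r_n)>0$ with $\sum_i P(r_i)=1$ the non-attacker's distribution, $0<p<1$ the probability that the agent is an attacker, $c_d>0$ the detection cost and $c_{fa}>0$ the false alarm cost. In the reduced game $G^{R,T}$ the attacker picks a reward $r_i$, $1\le i\le n$, and the defender picks a threshold classifier $c_j$, $1\le j\le n+1$: $c_j$ detects $r_i$ iff $i\ge j$ (so $c_{n+1}$ never detects). The payoffs are $U^A(i,j)=r_i-c_d 1_{i\ge j}$ and $U^D(i,j)=-U^A(i,j)-\mu_j$, where $\mu_j=\frac{1-p}{p}c_{fa}\sum_{i\ge j}P(r_i)$. Mixed strategies are probability vectors $\alpha\in\mathbb R^n$ (attacker) and $\beta\in\mathbb R^{n+1}$ (defender), payoffs are extended bilinearly, and NE means Nash equilibrium in mixed strategies. Put $$\Delta_i=\frac{r_i-r_{i-1}}{c_d}\ (2\le i\le n),\qquad w_i=\frac{1-p}{p}\,\frac{c_{fa}}{c_d}\,P(r_i)\ (1\le i\le n),$$ and read $\Delta_1=+\infty$ (there is no $r_0$). Algorithm 1. For $s\in\{1,\dots,n\}$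 put $\rho_s=1-\sum_{i>s}\Delta_i$. The vectors $\beta^{1}(s)$ and $\beta^{2}(s)$ have entries $0$ for $i<s$ and $\Delta_i$ for $s<i\le n$; in $\beta^1(s)$ entry $s$ is $\rho_s$ and entry $n+1$ is $0$, in $\beta^2(s)$ entry $s$ is $0$ and entry $n+1$ is $\rho_s$. Only those $s$ with $\rho_s\ge0$ are admitted. Fix $\varepsilon>0$, let $\Lambda_{ij}=c_d1_{i\ge j}-r_i+r_n+\varepsilon$ and $U(\beta)=\min_i(\Lambda\beta)_i-\sum_j\mu_j\beta_j$. Let $U_t$ be the largest $U(\beta^t(s))$ and $s_t$ an index attaining it ($t=1,2$). For a set $B$ of defender strategies and an index $k$, the set $A(B,k)$ of attacker strategies is found thus: $\alpha_i=0$ for $i<k$ and $\alpha_i=w_i$ for $k<i<n$; then (a) if some $\beta\in B$ has $\beta_k>0$, assign $\alpha_k=w_k$ and then $\alpha_n=1-\sum_{k\le i<n}\alpha_i$; (b) otherwise, if some $\beta\in B$ has $\beta_{n+1}>0$, assign $\alpha_n=w_n$ and then $\alpha_k=1-\sum_{k<i\le n}\alpha_i$; (c) otherwise, take the segment between the two vectors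 obtained by assigning $\alpha_k=0$, respectively $\alpha_k=\min(w_k,\,1-\sum_{k<i<n}\alpha_i)$, and then $\alpha_n=1-\sum_{k\le i<n}\alpha_i$. (If $k=n$ the later assignment overrides the earlier one.) The algorithm returns all $(\alpha,\beta)$ with $\beta\in B$ and $\alpha\in A(B,k)$, where - if $U_1>U_2$: $B=\{\beta^1(s_1)\}$, $k=s_1$; - if $U_1<U_2$ and $s_2$ is unique: $B=\{\beta^2(s_2)\}$, $k=s_2$; if there are two optimal indices $s_2$ and $s_2+1$: $B=[\beta^2(s_2),\beta^2(s_2+1)]$ (a segment), $k=s_2+1$; - if $U_1=U_2$ and $s_2$ is unique, take $s_1=s_2$: $B=[\beta^1(s_1),\beta^2(s_1)]$ (a single point if the two coincide), $k=s_1$; if there are two optimal indices $s_2$ and $s_2+1$: $B=[\beta^1(s_2),\beta^2(s_2+1)]$, $k=s_2+1$. Theorem. (1) Algorithm 1 finds all NE: every NE $(\alpha,\beta)$ of $G^{R,T}$ is among the pairs returned. A returned pair is a NE if and only if ($\beta_{n+1}=0$ implies $\alpha_n\ge w_n$). Unless there is an index $k$ with $r_n-r_k=c_d$ and $\sum_{i>k}w_i<1<\sum_{i\ge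 k}w_i$, the set of returned pairs is exactly the set of NE. (2) If $(\alpha,\beta)$ is a NE, then there is $k\in\{1,\dots,n\}$ such that $\alpha_i=\beta_i=0$ for $i<k$, $\beta_i=\Delta_i$ for $k<i\le n$, $\alpha_i=w_i$ for $k<i<n$, and $\beta_k,\beta_{n+1},\alpha_k,\alpha_n\ge 0$ satisfy one of: (i) $0<\beta_k<\Delta_k$, $\beta_{n+1}=0$, $\alpha_n>0$, and $\alpha_k=w_k$ if $k<n$; (ii) $\beta_k=0$, $\beta_{n+1}>0$, $0<\alpha_k<w_k$, and $\alpha_n=w_n$ if $k<n$; (iii) $\beta_k=0$, $\beta_{n+1}=0$, $0\le\alpha_k\le\min\bigl(w_k,\,1-\sum_{k<i<n}\alpha_i\bigr)$, $\alpha_n\ge 0$; (iv) $0\le\beta_k\le\Delta_k$, $\beta_{n+1}\ge 0$, $\alpha_k=w_k$, $\alpha_n=w_n$. -/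

import Mathlib

open Finset

noncomputable section

/-- The data of the reduced classification game, with `n = m + 1` distinct rewards
`r 0 < r 1 < … < r m`. The rewards are indexed by `Fin (m + 1)`; the threshold classifiers
are indexed by `Fin (m + 2)`, the last one being "always classify as non-attacker". -/
structure ReducedGame (m : ℕ) where
  /-- the attacker's rewards, in increasing order -/
  r : Fin (m + 1) → ℝ
  r_nonneg : ∀ i, 0 ≤ r i
  r_strictMono : StrictMono r
  /-- the non-attacker's distribution on the rewards -/
  P : Fin (m + 1) → ℝ
  P_nonneg : ∀ i, 0 ≤ P i
  P_sum : ∑ i, P i = 1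
  /-- probability that the agent is an attacker -/
  p : ℝ
  p_nonneg : 0 ≤ p
  p_le_one : p ≤ 1
  /-- cost of detection -/
  cd : ℝ
  cd_nonneg : 0 ≤ cd
  /-- cost of a false alarm -/
  cfa : ℝ
  cfa_nonneg : 0 ≤ cfa

namespace ReducedGame

variable {m : ℕ} (G : ReducedGame m)

/-! ### Classifiers, payoffs, Nash equilibria -/

/-- The thresholds: the rewards, and one number above all rewards. -/
def threshold (j : Fin (m + 2)) : ℝ :=
  Fin.lastCases (motive := fun _ => ℝ) (G.r (Fin.last m) + 1) (fun i => G.r i) j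

/-- The `j`-th threshold classifier: reward `r i` is classified as an attack
iff it is at least the threshold. -/
def Detects (j : Fin (m + 2)) (i : Fin (m + 1)) : Prop := G.threshold j ≤ G.r i

open Classical in
/-- Indicator of detection. -/
def detect (j : Fin (m + 2)) (i : Fin (m + 1)) : ℝ := if G.Detects j i then 1 else 0

/-- Attacker's payoff for reward `i` against classifier `j`. -/
def payoffA (i : Fin (m + 1)) (j : Fin (m + 2)) : ℝ := G.r i - G.cd * G.detect j i

/-- Defender's payoff for classifier `j` against reward `i`. -/
def payoffD (i : Fin (m + 1)) (j : Fin (m + 2)) : ℝ :=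
  -G.payoffA i j - (1 - G.p) / G.p * G.cfa * ∑ i', G.P i' * G.detect j i'

/-- Attacker's expected payoff in mixed strategies. -/
def expA (α : Fin (m + 1) → ℝ) (β : Fin (m + 2) → ℝ) : ℝ :=
  ∑ i, ∑ j, α i * G.payoffA i j * β j

/-- Defender's expected payoff in mixed strategies. -/
def expD (α : Fin (m + 1) → ℝ) (β : Fin (m + 2) → ℝ) : ℝ :=
  ∑ i, ∑ j, α i * G.payoffD i j * β j

/-- Nash equilibria in mixed strategies. -/
def IsNash (α : Fin (m + 1) → ℝ) (β : Fin (m + 2) → ℝ) : Prop :=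
  α ∈ stdSimplex ℝ (Fin (m + 1)) ∧ β ∈ stdSimplex ℝ (Fin (m + 2)) ∧
  (∀ α' ∈ stdSimplex ℝ (Fin (m + 1)), G.expA α' β ≤ G.expA α β) ∧
  (∀ β' ∈ stdSimplex ℝ (Fin (m + 2)), G.expD α β' ≤ G.expD α β)

/-! ### The two equilibrium weights -/

/-- `(r_i - r_{i-1}) / c_d`; meant for indices `i` that are not the first one. -/
def gap (i : Fin (m + 1)) : ℝ :=
  (G.r i - G.r ⟨i.val - 1, lt_of_le_of_lt (Nat.sub_le _ _) i.isLt⟩) / G.cd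

/-- `((1-p)/p) (c_fa/c_d) P(r_i)`. -/
def weight (i : Fin (m + 1)) : ℝ := (1 - G.p) / G.p * (G.cfa / G.cd) * G.P i

/-! ### The algorithm -/

/-- The false alarm penalty vector. -/
def mu (j : Fin (m + 2)) : ℝ :=
  (1 - G.p) / G.p * G.cfa * ∑ i : Fin (m + 1) with j ≤ i.castSucc, G.P i

/-- The attacker's cost matrix, shifted by a constant that makes it positive. -/
def costMatrix (ε : ℝ) : Matrix (Fin (m + 1)) (Fin (m + 2)) ℝ := fun i j =>
  G.cd * G.detect j i - G.r i + (G.r (Fin.last m) + ε)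

/-- `min (Λ β) - μ' β`. -/
def guarantee (ε : ℝ) (β : Fin (m + 2) → ℝ) : ℝ :=
  univ.inf' univ_nonempty ((G.costMatrix ε).mulVec β) - ∑ j, G.mu j * β j

/-- The two types of candidate strategies of the defender. -/
inductive CandidateType
  | one
  | two

/-- What remains of the total mass `1` after the weights `gap i`, `i > s`. -/
def remainder (s : Fin (m + 1)) : ℝ := 1 - ∑ i ∈ Ioi s, G.gap i

/-- The subroutine that builds the defender's candidate of a given type and starting index:
weight `0` below `s`, weight `gap i` above `s`, and the remainder on `s` (first type) or on the
last classifier (second type). -/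
def computeBeta (s : Fin (m + 1)) : CandidateType → Fin (m + 2) → ℝ
  | .one => fun j => Fin.lastCases (motive := fun _ => ℝ) 0
      (fun i => if i < s then 0 else if i = s then G.remainder s else G.gap i) j
  | .two => fun j => Fin.lastCases (motive := fun _ => ℝ) (G.remainder s)
      (fun i => if i < s then 0 else if i = s then 0 else G.gap i) j

/-- The starting indices of the best candidates of a given type, among those candidates that
are mixed strategies (that is, with a nonnegative remainder). -/
def bestIndices (ε : ℝ) (t : CandidateType) : Set (Fin (m + 1)) :=
  {s | G.computeBeta s t ∈ stdSimplex ℝ (Fin (m + 2)) ∧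
    ∀ s', G.computeBeta s' t ∈ stdSimplex ℝ (Fin (m + 2)) →
      G.guarantee ε (G.computeBeta s' t) ≤ G.guarantee ε (G.computeBeta s t)}

/-- Weights `0` below `k` and `weight i` above `k`. The entries at `k` and at the last index are
assigned afterwards. -/
def alphaBase (k : Fin (m + 1)) : Fin (m + 1) → ℝ :=
  fun i => if i < k then 0 else G.weight i

/-- Assign the value `x` to `α_k`, then the remaining mass `1 - ∑_{k ≤ i < n} α_i` to `α_n`. -/
def alphaFillLast (k : Fin (m + 1)) (x : ℝ) : Fin (m + 1) → ℝ :=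
  let α := Function.update (G.alphaBase k) k x
  Function.update α (Fin.last m) (1 - ∑ i ∈ Ico k (Fin.last m), α i)

/-- Assign `weight n` to `α_n`, then the remaining mass `1 - ∑_{k < i ≤ n} α_i` to `α_k`. -/
def alphaFillFirst (k : Fin (m + 1)) : Fin (m + 1) → ℝ :=
  let α := Function.update (G.alphaBase k) (Fin.last m) (G.weight (Fin.last m))
  Function.update α k (1 - ∑ i ∈ Ioc k (Fin.last m), α i)

open Classical in
/-- The subroutine that returns the set of attacker's strategies, given the set `B` of the
defender's strategies and the starting index `k`. -/
def computeAlpha (B : Set (Fin (m + 2) → ℝ)) (k : Fin (m + 1)) : Set (Fin (m + 1) → ℝ) :=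
  if ∃ β ∈ B, 0 < β k.castSucc then {G.alphaFillLast k (G.weight k)}
  else if ∃ β ∈ B, 0 < β (Fin.last (m + 1)) then {G.alphaFillFirst k}
  else segment ℝ (G.alphaFillLast k 0)
    (G.alphaFillLast k (min (G.weight k) (1 - ∑ i ∈ Ioo k (Fin.last m), G.weight i)))

/-- All pairs of a defender's strategy in `B` and an attacker's strategy computed from `B`. -/
def outputs (B : Set (Fin (m + 2) → ℝ)) (k : Fin (m + 1)) :
    Set ((Fin (m + 1) → ℝ) × (Fin (m + 2) → ℝ)) :=
  G.computeAlpha B k ×ˢ B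

/-- The set of strategy profiles returned by the algorithm. Here `s₁`, `s₂` are best indices of
the first and of the second type, and the algorithm branches on the comparison of the optimal
values of the two types and on the uniqueness of `s₂`. -/
def algorithmOutput (ε : ℝ) : Set ((Fin (m + 1) → ℝ) × (Fin (m + 2) → ℝ)) :=
  {x | ∃ s₁ ∈ G.bestIndices ε .one, ∃ s₂ ∈ G.bestIndices ε .two,
    let U₁ := G.guarantee ε (G.computeBeta s₁ .one)
    let U₂ := G.guarantee ε (G.computeBeta s₂ .two)
    (U₁ > U₂ ∧ x ∈ G.outputs {G.computeBeta s₁ .one} s₁) ∨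
    (U₁ < U₂ ∧
      ((G.bestIndices ε .two = {s₂} ∧ x ∈ G.outputs {G.computeBeta s₂ .two} s₂) ∨
       (∃ s₂' ∈ G.bestIndices ε .two, s₂'.val = s₂.val + 1 ∧
          x ∈ G.outputs (segment ℝ (G.computeBeta s₂ .two) (G.computeBeta s₂' .two)) s₂'))) ∨
    (U₁ = U₂ ∧
      ((G.bestIndices ε .two = {s₂} ∧ s₁ = s₂ ∧
          ((G.computeBeta s₁ .one ≠ G.computeBeta s₁ .two ∧
              x ∈ G.outputs (segment ℝ (G.computeBeta s₁ .one) (G.computeBeta s₁ .two)) s₁) ∨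
           (G.computeBeta s₁ .one = G.computeBeta s₁ .two ∧
              x ∈ G.outputs {G.computeBeta s₁ .one} s₁))) ∨
       (∃ s₂' ∈ G.bestIndices ε .two, s₂'.val = s₂.val + 1 ∧
          x ∈ G.outputs (segment ℝ (G.computeBeta s₂ .one) (G.computeBeta s₂' .two)) s₂')))}

/-! ### The form of the equilibria -/

/-- The form of an equilibrium with starting index `k`. The bound `(r_k - r_{k-1}) / c_d` on
`β_k` is absent if `k` is the first index, and where `k` is the last index the entries `α_k` and
`α_n` are the same number. -/
def HasForm (k : Fin (m + 1)) (α : Fin (m + 1) → ℝ) (β : Fin (m + 2) → ℝ) : Prop :=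
  let n := Fin.last m
  let βk := β k.castSucc
  let βlast := β (Fin.last (m + 1))
  (∀ i < k, β i.castSucc = 0) ∧ (∀ i < k, α i = 0) ∧
  (∀ i > k, β i.castSucc = G.gap i) ∧
  (∀ i, k < i → i < n → α i = G.weight i) ∧
  0 ≤ βk ∧ 0 ≤ βlast ∧ 0 ≤ α k ∧ 0 ≤ α n ∧
  ((0 < βk ∧ (0 < k → βk < G.gap k) ∧ βlast = 0 ∧
      (k < n → α k = G.weight k) ∧ 0 < α n) ∨
   (βk = 0 ∧ 0 < βlast ∧
      0 < α k ∧ α k < G.weight k ∧ (k < n → α n = G.weight n)) ∨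
   (βk = 0 ∧ βlast = 0 ∧
      0 ≤ α k ∧ α k ≤ min (G.weight k) (1 - ∑ i ∈ Ioo k n, α i) ∧ 0 ≤ α n) ∨
   (0 ≤ βk ∧ (0 < k → βk ≤ G.gap k) ∧ 0 ≤ βlast ∧
      α k = G.weight k ∧ α n = G.weight n))

/-- The enumerated classifiers are exactly the classifiers "reward at least `t`", `t` real. -/
theorem range_detects :
    Set.range G.Detects = {c | ∃ t : ℝ, c = fun i => t ≤ G.r i} := by
  ext c
  constructor
  · rintro ⟨j, rfl⟩
    exact ⟨G.threshold j, rfl⟩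
  · rintro ⟨t, rfl⟩
    by_cases h : ∃ i, t ≤ G.r i
    · classical
      have hne : (univ.filter fun i => t ≤ G.r i).Nonempty := by
        obtain ⟨i, hi⟩ := h
        exact ⟨i, by simp [hi]⟩
      set i₀ := (univ.filter fun i => t ≤ G.r i).min' hne with hi₀
      have h₀ : t ≤ G.r i₀ := by
        have := Finset.min'_mem _ hne
        rw [← hi₀] at this
        simpa using this
      refine ⟨i₀.castSucc, funext fun i => propext ?_⟩
      simp only [Detects, threshold, Fin.lastCases_castSucc]
      constructor
      · exact fun hi => h₀.trans hi
      · intro hi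
        exact G.r_strictMono.monotone (Finset.min'_le _ _ (by simp [hi]))
    · push Not at h
      refine ⟨Fin.last (m + 1), funext fun i => propext ?_⟩
      simp only [Detects, threshold, Fin.lastCases_last]
      have h₁ : G.r i ≤ G.r (Fin.last m) := G.r_strictMono.monotone (Fin.le_last i)
      constructor
      · intro h₂
        linarith
      · intro h₂
        exact absurd h₂ (not_le.mpr (h i))

end ReducedGame

end

noncomputable section

namespace ReducedGame

variable {m : ℕ} (G : ReducedGame m)

/-! ### Linear functions on the simplex -/

/-! Against β, reward i earns r_i - c_d ∑_{j ≤ i} β_j (`valueA`). Against α, up to the factor c_d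
and a term independent of j, threshold j earns ∑_{i ≥ j} (α_i - w_i), and the last classifier earns
0 (`valueD`). A profile is an equilibrium iff each support consists of maximizers of these values
(`isNash_iff`). From i-1 to i the first value changes by c_d (Δ_i - β_i) and the second by w_{i-1} -
α_{i-1}, so indifference between neighbours forces β_i = Δ_i and α_{i-1} = w_{i-1}.

Let k be the least reward in the attacker's support. Thresholds below k only add false alarms, so
they are unused. Thresholds above k are all used: if i is unused, reward i beats reward i-1, so
α_{i-1} = 0, so threshold i-1 is unused, and so on down to k, where α_k > 0 is contradicted. This
gives `IsEquilibriumFrom`, with freedom left only at k and at the end. With W_k = ∑_{i ≥ k} w_i,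
total mass 1 means β_k + β_{n+1} = ρ_k and, for k < n, 1 - W_k = (α_k - w_k) + (α_n - w_n).

Since ρ is strictly increasing and W strictly decreasing, two indices control everything
(`IsPivot`): a, the first with ρ_a ≥ 0, and k, the last index from a on with W_k ≥ 1 (or a if there
is none). An equilibrium using the last classifier starts at k; any other starts at a, or just after
a if ρ_a = 0 (`IsPivot.start_cases`).

On the algorithm's side, U(β²(s)) = ε + c_d ∑_{i > s} Δ_i (1 - W_i), which is maximal at k, with a
tie only at k-1 when W_k = 1. The candidate β¹(a) adds c_d ρ_a (1 - W_a), and β¹(s) with s > a never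
beats the best second candidate. So the branch taken depends only on whether k = a, whether ρ_a = 0,
and the sign of W_k - 1; in each case the output is compared with the equilibria. They can differ
only if k = a and ρ_a = 0: the returned segment may then contain α_n < w_n, against which the
defender prefers never to detect. This requires also W_k > 1, which is the excluded degenerate case.
-/

theorem forall_stdSimplex_sum_le_iff {ι : Type*} [Fintype ι] {x : ι → ℝ}
    (hx : x ∈ stdSimplex ℝ ι) (c : ι → ℝ) :
    (∀ y ∈ stdSimplex ℝ ι, ∑ i, y i * c i ≤ ∑ i, x i * c i) ↔
      ∀ i i', 0 < x i → c i' ≤ c i := by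
  classical
  constructor
  · intro h i i' hi
    by_contra! hlt
    set M := ∑ i, x i * c i with hM
    -- Optimality is tested against the vertices of the simplex.
    have hle : ∀ j, c j ≤ M := fun j => by
      simpa [Pi.single_apply] using h _ (single_mem_stdSimplex ℝ j)
    have : ∑ j, x j * c j < ∑ j, x j * M := by
      refine sum_lt_sum (fun j _ => mul_le_mul_of_nonneg_left (hle j) (hx.1 j)) ⟨i, mem_univ _, ?_⟩
      exact mul_lt_mul_of_pos_left (hlt.trans_le (hle i')) hi
    rw [← sum_mul, hx.2, one_mul] at this
    exact this.false
  · intro h y hy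
    obtain ⟨i, -, hi⟩ : ∃ i ∈ univ, 0 < x i := by
      by_contra! hcon
      have := sum_nonpos hcon
      rw [hx.2] at this
      linarith
    have h1 : ∑ j, x j * c j = c i := by
      have : ∀ j, x j * c j = x j * c i := fun j => by
        rcases (hx.1 j).eq_or_lt with h0 | h0
        · simp [← h0]
        · rw [le_antisymm (h i j hi) (h j i h0)]
      simp_rw [this]
      rw [← sum_mul, hx.2, one_mul]
    rw [h1]
    calc ∑ j, y j * c j ≤ ∑ j, y j * c i :=
          sum_le_sum fun j _ => mul_le_mul_of_nonneg_left (h i j hi) (hy.1 j)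
      _ = c i := by rw [← sum_mul, hy.2, one_mul]

/-! ### Predecessors and telescoping sums -/

/-- The preceding index; it is `0` at `0`. -/
def prev (i : Fin (m + 1)) : Fin (m + 1) :=
  ⟨i.val - 1, lt_of_le_of_lt (Nat.sub_le _ _) i.isLt⟩

theorem prev_lt {i : Fin (m + 1)} (hi : 0 < i) : prev i < i := by
  rw [Fin.lt_def] at *
  simp only [prev, Fin.val_zero] at *
  omega

theorem le_prev {i j : Fin (m + 1)} (h : i < j) : i ≤ prev j := by
  rw [Fin.lt_def] at h
  rw [Fin.le_def]
  simp only [prev]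
  omega

theorem prev_lt_iff {i j : Fin (m + 1)} (hi : 0 < i) : prev i < j ↔ i ≤ j := by
  rw [Fin.lt_def, Fin.le_def]
  rw [Fin.lt_def] at hi
  simp only [prev, Fin.val_zero] at *
  omega

theorem val_prev_add_one {t : Fin (m + 1)} (h : 0 < t) : t.val = (prev t).val + 1 := by
  rw [Fin.lt_def] at h
  simp only [prev, Fin.val_zero] at *
  omega

/-- Lets steps to the next index be phrased through `prev` as well. -/
theorem exists_eq_prev {i : Fin (m + 1)} (hi : i < Fin.last m) : ∃ j, i = prev j ∧ i < j := by
  have h1 : i.val < m := hi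
  exact ⟨⟨i.val + 1, by omega⟩, Fin.ext (by simp [prev]), by simp [Fin.lt_def]⟩

theorem Ioi_prev {i : Fin (m + 1)} (hi : 0 < i) : Ioi (prev i) = Ici i := by
  ext j
  simp [prev_lt_iff hi]

theorem sum_Ici_eq_add_Ioi (f : Fin (m + 1) → ℝ) (i : Fin (m + 1)) :
    ∑ j ∈ Ici i, f j = f i + ∑ j ∈ Ioi i, f j := by
  rw [← Finset.Ioi_insert, sum_insert (by simp)]

theorem sum_Ici_prev (f : Fin (m + 1) → ℝ) {i : Fin (m + 1)} (hi : 0 < i) :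
    ∑ j ∈ Ici (prev i), f j = f (prev i) + ∑ j ∈ Ici i, f j := by
  rw [sum_Ici_eq_add_Ioi, Ioi_prev hi]

theorem sum_Iic_eq_add_prev (f : Fin (m + 1) → ℝ) {i : Fin (m + 1)} (hi : 0 < i) :
    ∑ j ∈ Iic i, f j = ∑ j ∈ Iic (prev i), f j + f i := by
  have : Iic i = insert i (Iic (prev i)) := by
    ext j
    simp only [mem_Iic, mem_insert]
    constructor
    · intro h
      rcases h.eq_or_lt with h | h
      · exact Or.inl h
      · exact Or.inr (le_prev h)
    · rintro (rfl | h)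
      · exact le_rfl
      · exact h.trans (prev_lt hi).le
  rw [this, sum_insert (by simpa using prev_lt hi), add_comm]

theorem sum_Ioc_sub_prev (f : Fin (m + 1) → ℝ) {s t : Fin (m + 1)} (h : s ≤ t) :
    ∑ i ∈ Ioc s t, (f i - f (prev i)) = f t - f s := by
  induction t using WellFoundedLT.induction with
  | ind t ih =>
    rcases h.eq_or_lt with rfl | h
    · simp
    · have h0 : 0 < t := (Fin.zero_le s).trans_lt h
      have : Ioc s t = insert t (Ioc s (prev t)) := by
        ext j
        simp only [mem_Ioc, mem_insert]
        constructor
        · rintro ⟨h1, h2⟩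
          rcases h2.eq_or_lt with h2 | h2
          · exact Or.inl h2
          · exact Or.inr ⟨h1, le_prev h2⟩
        · rintro (rfl | h')
          · exact ⟨h, le_rfl⟩
          · exact ⟨h'.1, h'.2.trans (prev_lt h0).le⟩
      rw [this, sum_insert (by simpa using fun _ => prev_lt h0), ih _ (prev_lt h0) (le_prev h)]
      ring

theorem gap_eq (i : Fin (m + 1)) : G.gap i = (G.r i - G.r (prev i)) / G.cd := rfl

theorem sum_Ioc_gap {s t : Fin (m + 1)} (h : s ≤ t) :
    ∑ i ∈ Ioc s t, G.gap i = (G.r t - G.r s) / G.cd := by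
  simp_rw [gap_eq]
  rw [← sum_div, sum_Ioc_sub_prev _ h]

theorem remainder_eq (s : Fin (m + 1)) :
    G.remainder s = 1 - (G.r (Fin.last m) - G.r s) / G.cd := by
  have : Ioi s = Ioc s (Fin.last m) := by ext; simp [Fin.le_last]
  rw [remainder, this, G.sum_Ioc_gap (Fin.le_last s)]

theorem gap_pos (hcd : 0 < G.cd) {i : Fin (m + 1)} (hi : 0 < i) : 0 < G.gap i :=
  div_pos (sub_pos.2 (G.r_strictMono (prev_lt hi))) hcd

theorem remainder_prev (i : Fin (m + 1)) : G.remainder (prev i) = G.remainder i - G.gap i := by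
  rw [remainder_eq, remainder_eq, gap_eq]
  ring

theorem remainder_strictMono (hcd : 0 < G.cd) : StrictMono G.remainder := by
  intro i j h
  rw [remainder_eq, remainder_eq]
  have : (G.r (Fin.last m) - G.r j) / G.cd < (G.r (Fin.last m) - G.r i) / G.cd :=
    div_lt_div_of_pos_right (by linarith [G.r_strictMono h]) hcd
  linarith

theorem remainder_last : G.remainder (Fin.last m) = 1 := by
  rw [remainder_eq]; simp

/-! ### Payoffs -/

theorem detect_eq (j : Fin (m + 2)) (i : Fin (m + 1)) :
    G.detect j i = if j ≤ i.castSucc then 1 else 0 := by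
  have : G.Detects j i ↔ j ≤ i.castSucc := by
    induction j using Fin.lastCases with
    | last =>
      simp only [Detects, threshold, Fin.lastCases_last]
      have h₁ : G.r i ≤ G.r (Fin.last m) := G.r_strictMono.monotone (Fin.le_last i)
      constructor
      · intro h; linarith
      · intro h; exact absurd h (not_le.2 (Fin.castSucc_lt_last i))
    | cast j =>
      simp only [Detects, threshold, Fin.lastCases_castSucc, Fin.castSucc_le_castSucc_iff]
      exact G.r_strictMono.le_iff_le
  simp only [detect, this]

theorem sum_detect_castSucc (i : Fin (m + 1)) (f : Fin (m + 1) → ℝ) :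
    ∑ i', f i' * G.detect i.castSucc i' = ∑ i' ∈ Ici i, f i' := by
  simp only [detect_eq, Fin.castSucc_le_castSucc_iff, mul_ite, mul_one, mul_zero]
  rw [← sum_filter]
  congr 1
  ext; simp

theorem sum_detect_last (f : Fin (m + 1) → ℝ) :
    ∑ i', f i' * G.detect (Fin.last (m + 1)) i' = 0 := by
  simp [detect_eq]

theorem sum_detect_mul (i : Fin (m + 1)) (β : Fin (m + 2) → ℝ) :
    ∑ j, G.detect j i * β j = ∑ j ∈ Iic i, β j.castSucc := by
  rw [Fin.sum_univ_castSucc]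
  have : ¬ (Fin.last (m + 1) ≤ i.castSucc) := not_le.2 (Fin.castSucc_lt_last i)
  simp only [detect_eq, Fin.castSucc_le_castSucc_iff, ite_mul, one_mul, zero_mul, this,
    if_false, add_zero]
  rw [← sum_filter]
  congr 1
  ext; simp

/-- The attacker's payoff at a reward, against a mixed strategy of the defender. -/
def valueA (β : Fin (m + 2) → ℝ) (i : Fin (m + 1)) : ℝ :=
  G.r i - G.cd * ∑ j ∈ Iic i, β j.castSucc

/-- Up to scaling and a constant, the defender's payoff at a classifier, against a mixed
strategy of the attacker. -/
def valueD (α : Fin (m + 1) → ℝ) : Fin (m + 2) → ℝ :=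
  Fin.lastCases (motive := fun _ => ℝ) 0 fun j => ∑ i ∈ Ici j, (α i - G.weight i)

@[simp] theorem valueD_last (α : Fin (m + 1) → ℝ) : G.valueD α (Fin.last (m + 1)) = 0 := by
  simp [valueD]

@[simp] theorem valueD_castSucc (α : Fin (m + 1) → ℝ) (j : Fin (m + 1)) :
    G.valueD α j.castSucc = ∑ i ∈ Ici j, (α i - G.weight i) := by
  simp [valueD]

theorem expA_eq (α : Fin (m + 1) → ℝ) {β : Fin (m + 2) → ℝ}
    (hβ : β ∈ stdSimplex ℝ (Fin (m + 2))) : G.expA α β = ∑ i, α i * G.valueA β i := by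
  unfold expA
  refine sum_congr rfl fun i _ => ?_
  rw [valueA, ← G.sum_detect_mul]
  calc ∑ j, α i * G.payoffA i j * β j
      = ∑ j, (α i * G.r i * β j - α i * G.cd * (G.detect j i * β j)) :=
        sum_congr rfl fun j _ => by rw [payoffA]; ring
    _ = _ := by
        rw [sum_sub_distrib, ← mul_sum, ← mul_sum, hβ.2]
        ring

theorem cd_mul_weight (hcd : 0 < G.cd) (i : Fin (m + 1)) :
    G.cd * G.weight i = (1 - G.p) / G.p * G.cfa * G.P i := by
  rw [weight]
  field_simp

theorem valueD_eq (hcd : 0 < G.cd) (α : Fin (m + 1) → ℝ) (j : Fin (m + 2)) :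
    G.cd * G.valueD α j = G.cd * ∑ i, α i * G.detect j i
      - (1 - G.p) / G.p * G.cfa * ∑ i, G.P i * G.detect j i := by
  induction j using Fin.lastCases with
  | last => simp [sum_detect_last]
  | cast j =>
    rw [valueD_castSucc, sum_detect_castSucc, sum_detect_castSucc, sum_sub_distrib, mul_sub]
    congr 1
    rw [mul_sum, mul_sum]
    exact sum_congr rfl fun i _ => G.cd_mul_weight hcd i

/-- The attacker's mean reward does not depend on β, so it drops out when the defender's strategies
are compared. -/
theorem expD_eq (hcd : 0 < G.cd) {α : Fin (m + 1) → ℝ} {β : Fin (m + 2) → ℝ}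
    (hα : α ∈ stdSimplex ℝ (Fin (m + 1))) (hβ : β ∈ stdSimplex ℝ (Fin (m + 2))) :
    G.expD α β = G.cd * ∑ j, β j * G.valueD α j - ∑ i, α i * G.r i := by
  unfold expD
  rw [sum_comm]
  have : ∀ j, ∑ i, α i * G.payoffD i j * β j
      = G.cd * (β j * G.valueD α j) - (∑ i, α i * G.r i) * β j := fun j => by
    have h := G.valueD_eq hcd α j
    set c := (1 - G.p) / G.p * G.cfa * ∑ i, G.P i * G.detect j i with hc
    calc ∑ i, α i * G.payoffD i j * β j
        = ∑ i, (G.cd * (α i * G.detect j i) - α i * G.r i - α i * c) * β j :=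
          sum_congr rfl fun i _ => by rw [payoffD, payoffA, ← hc]; ring
      _ = (G.cd * ∑ i, α i * G.detect j i - ∑ i, α i * G.r i - c) * β j := by
          rw [← sum_mul, sum_sub_distrib, sum_sub_distrib, ← mul_sum, ← sum_mul, hα.2, one_mul]
      _ = _ := by linear_combination (-β j) * h
  simp_rw [this]
  rw [sum_sub_distrib, ← mul_sum, ← mul_sum, hβ.2, mul_one]

/-- Nash equilibria in terms of best responses. -/
theorem isNash_iff (hcd : 0 < G.cd) (α : Fin (m + 1) → ℝ) (β : Fin (m + 2) → ℝ) :
    G.IsNash α β ↔ α ∈ stdSimplex ℝ (Fin (m + 1)) ∧ β ∈ stdSimplex ℝ (Fin (m + 2)) ∧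
      (∀ i i', 0 < α i → G.valueA β i' ≤ G.valueA β i) ∧
      (∀ j j', 0 < β j → G.valueD α j' ≤ G.valueD α j) := by
  unfold IsNash
  refine and_congr_right fun hα => and_congr_right fun hβ => and_congr ?_ ?_
  · simp only [G.expA_eq _ hβ]
    exact forall_stdSimplex_sum_le_iff hα _
  · rw [← forall_stdSimplex_sum_le_iff hβ]
    refine forall₂_congr fun β' hβ' => ?_
    rw [G.expD_eq hcd hα hβ, G.expD_eq hcd hα hβ', sub_le_sub_iff_right, mul_le_mul_iff_right₀ hcd]

/-! ### Equilibria in terms of the starting index -/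

/-- Explicit equilibrium conditions with respect to a starting index `k`. -/
structure IsEquilibriumFrom (k : Fin (m + 1)) (α : Fin (m + 1) → ℝ) (β : Fin (m + 2) → ℝ) :
    Prop where
  mem_left : α ∈ stdSimplex ℝ (Fin (m + 1))
  mem_right : β ∈ stdSimplex ℝ (Fin (m + 2))
  left_zero : ∀ i < k, α i = 0
  right_zero : ∀ i < k, β i.castSucc = 0
  right_gap : ∀ i > k, β i.castSucc = G.gap i
  left_weight : ∀ i, k < i → i < Fin.last m → α i = G.weight i
  right_le : 0 < k → β k.castSucc ≤ G.gap k
  left_le : k < Fin.last m → α k ≤ G.weight k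
  le_left : k < Fin.last m → G.weight (Fin.last m) ≤ α (Fin.last m)
  of_right_pos : 0 < β k.castSucc → G.weight k ≤ α k
  of_last_pos : 0 < β (Fin.last (m + 1)) → α (Fin.last m) ≤ G.weight (Fin.last m)

/-- The total weight from an index on. -/
def tailWeight (i : Fin (m + 1)) : ℝ := ∑ j ∈ Ici i, G.weight j

/-! ### Tail weights and mass balances -/

theorem weight_pos (hp0 : 0 < G.p) (hp1 : G.p < 1) (hcd : 0 < G.cd) (hcfa : 0 < G.cfa)
    (hP : ∀ i, 0 < G.P i) (i : Fin (m + 1)) : 0 < G.weight i :=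
  mul_pos (mul_pos (div_pos (by linarith) hp0) (div_pos hcfa hcd)) (hP i)

theorem tailWeight_strictAnti (hw : ∀ i, 0 < G.weight i) : StrictAnti G.tailWeight := by
  intro i j h
  refine sum_lt_sum_of_subset (i := i) (Ici_subset_Ici.2 h.le) (by simp) (by simpa using h) (hw i)
    fun l _ _ => (hw l).le

theorem sum_Ici_of_left_zero {k : Fin (m + 1)} {α : Fin (m + 1) → ℝ}
    (h0 : ∀ i < k, α i = 0) : ∑ i ∈ Ici k, α i = ∑ i, α i := by
  refine sum_subset (subset_univ _) fun i _ hi => h0 i ?_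
  simpa using hi

/-- Every term cancels except the one at the last index, so the defender is indifferent among all
thresholds above `k`. -/
theorem sum_Ici_of_left_weight {k : Fin (m + 1)} {α : Fin (m + 1) → ℝ}
    (hw : ∀ i, k < i → i < Fin.last m → α i = G.weight i) {i : Fin (m + 1)} (hi : k < i) :
    ∑ j ∈ Ici i, (α j - G.weight j) = α (Fin.last m) - G.weight (Fin.last m) := by
  refine sum_eq_single_of_mem _ (by simp [Fin.le_last]) fun j hj hne => ?_
  rw [hw j (hi.trans_le (by simpa using hj)) (lt_of_le_of_ne (Fin.le_last j) hne), sub_self]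

theorem Ioi_last_eq_empty : Ioi (Fin.last m) = ∅ := by
  ext i
  simp [Fin.le_last]

theorem sum_Ici_last (f : Fin (m + 1) → ℝ) : ∑ j ∈ Ici (Fin.last m), f j = f (Fin.last m) := by
  rw [sum_Ici_eq_add_Ioi, Ioi_last_eq_empty, sum_empty, add_zero]

theorem tailWeight_last : G.tailWeight (Fin.last m) = G.weight (Fin.last m) := sum_Ici_last _

theorem sum_Ici_start {k : Fin (m + 1)} {α : Fin (m + 1) → ℝ}
    (hw : ∀ i, k < i → i < Fin.last m → α i = G.weight i) (hk : k < Fin.last m) :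
    ∑ j ∈ Ici k, (α j - G.weight j) =
      α k - G.weight k + (α (Fin.last m) - G.weight (Fin.last m)) := by
  have h1 : ∑ j ∈ Ioi k, (α j - G.weight j) = α (Fin.last m) - G.weight (Fin.last m) := by
    refine sum_eq_single_of_mem _ (by simpa using hk) fun j hj hne => ?_
    rw [hw j (by simpa using hj) (lt_of_le_of_ne (Fin.le_last j) hne), sub_self]
  rw [sum_Ici_eq_add_Ioi, h1]

theorem one_sub_tailWeight {k : Fin (m + 1)} {α : Fin (m + 1) → ℝ}
    (h0 : ∀ i < k, α i = 0) (h1 : ∑ i, α i = 1) :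
    1 - G.tailWeight k = ∑ j ∈ Ici k, (α j - G.weight j) := by
  rw [sum_sub_distrib, sum_Ici_of_left_zero h0, h1, tailWeight]

/-- Mass balance for an attacker's strategy with starting index `k`, not the last one. -/
theorem balance {k : Fin (m + 1)} {α : Fin (m + 1) → ℝ}
    (h0 : ∀ i < k, α i = 0) (h1 : ∑ i, α i = 1)
    (hw : ∀ i, k < i → i < Fin.last m → α i = G.weight i) (hk : k < Fin.last m) :
    1 - G.tailWeight k = α k - G.weight k + (α (Fin.last m) - G.weight (Fin.last m)) := by
  rw [G.one_sub_tailWeight h0 h1, G.sum_Ici_start hw hk]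

theorem left_last_eq_one {α : Fin (m + 1) → ℝ}
    (h0 : ∀ i < Fin.last m, α i = 0) (h1 : ∑ i, α i = 1) : α (Fin.last m) = 1 := by
  rw [← h1, ← sum_Ici_of_left_zero h0, sum_Ici_last]

theorem sum_Iic_right {k : Fin (m + 1)} {β : Fin (m + 2) → ℝ}
    (h0 : ∀ i < k, β i.castSucc = 0) (hg : ∀ i > k, β i.castSucc = G.gap i)
    {i : Fin (m + 1)} (hi : k ≤ i) :
    ∑ j ∈ Iic i, β j.castSucc = β k.castSucc + (G.r i - G.r k) / G.cd := by
  have h1 : ∑ j ∈ Iic i, β j.castSucc = ∑ j ∈ Icc k i, β j.castSucc := by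
    symm
    refine sum_subset (fun j hj => by simpa using (mem_Icc.1 hj).2) fun j hj hj' => h0 j ?_
    rw [mem_Iic] at hj
    rw [mem_Icc] at hj'
    exact not_le.1 fun h => hj' ⟨h, hj⟩
  rw [h1, ← Finset.Ioc_insert_left hi, sum_insert (by simp), ← G.sum_Ioc_gap hi]
  congr 1
  exact sum_congr rfl fun j hj => hg j (mem_Ioc.1 hj).1

theorem right_add_last {k : Fin (m + 1)} {β : Fin (m + 2) → ℝ}
    (h0 : ∀ i < k, β i.castSucc = 0) (hg : ∀ i > k, β i.castSucc = G.gap i) :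
    ∑ j, β j = β k.castSucc + (1 - G.remainder k) + β (Fin.last (m + 1)) := by
  have : Iic (Fin.last m) = univ := by ext; simp [Fin.le_last]
  rw [Fin.sum_univ_castSucc, ← this, G.sum_Iic_right h0 hg (Fin.le_last k), remainder_eq]
  ring

/-- Both values are flat above the start. Below it the attacker gets the bare reward, at most
r_{k-1}, which `right_le` keeps from being better; the defender gets 1 minus a larger tail weight.
-/
theorem IsEquilibriumFrom.isNash {G : ReducedGame m} {k : Fin (m + 1)}
    {α : Fin (m + 1) → ℝ} {β : Fin (m + 2) → ℝ}
    (hcd : 0 < G.cd) (hw : ∀ i, 0 < G.weight i)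
    (h : G.IsEquilibriumFrom k α β) : G.IsNash α β := by
  rw [G.isNash_iff hcd]
  refine ⟨h.mem_left, h.mem_right, ?_, ?_⟩
  · have hge : ∀ i, k ≤ i → G.valueA β i = G.r k - G.cd * β k.castSucc := fun i hi => by
      rw [valueA, G.sum_Iic_right h.right_zero h.right_gap hi]
      field_simp
      ring
    have hlt : ∀ i, i < k → G.valueA β i ≤ G.r k - G.cd * β k.castSucc := fun i hi => by
      have h0 : 0 < k := (Fin.zero_le i).trans_lt hi
      have h1 : ∑ j ∈ Iic i, β j.castSucc = 0 :=
        sum_eq_zero fun j hj => h.right_zero j ((mem_Iic.1 hj).trans_lt hi)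
      have h2 := G.r_strictMono.monotone (le_prev hi)
      have h3 := h.right_le h0
      rw [gap_eq, le_div_iff₀ hcd] at h3
      rw [valueA, h1]
      linarith
    intro i i' hi
    have hki : k ≤ i := by
      by_contra! hc
      rw [h.left_zero i hc] at hi
      exact hi.false
    rw [hge i hki]
    rcases lt_or_ge i' k with h' | h'
    · exact hlt i' h'
    · exact (hge i' h').le
  · set V := α (Fin.last m) - G.weight (Fin.last m) with hV
    have hgt : ∀ i, k < i → G.valueD α i.castSucc = V := fun i hi => by
      rw [valueD_castSucc, G.sum_Ici_of_left_weight h.left_weight hi]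
    have hlt : ∀ i, i < k → G.valueD α i.castSucc ≤ G.valueD α k.castSucc := fun i hi => by
      rw [valueD_castSucc, valueD_castSucc, sum_sub_distrib, sum_sub_distrib,
        sum_Ici_of_left_zero h.left_zero,
        sum_Ici_of_left_zero fun j hj => h.left_zero j (hj.trans hi)]
      have := G.tailWeight_strictAnti hw hi
      simp only [tailWeight] at this
      linarith
    rcases (Fin.le_last k).lt_or_eq with hk | hk
    · have hstart : G.valueD α k.castSucc = α k - G.weight k + V := by
        rw [valueD_castSucc, G.sum_Ici_start h.left_weight hk]
      have h1 := h.left_le hk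
      have h2 := h.le_left hk
      have hle : ∀ j, G.valueD α j ≤ V := fun j => by
        induction j using Fin.lastCases with
        | last => rw [valueD_last]; linarith
        | cast j =>
          rcases lt_trichotomy j k with hj | rfl | hj
          · linarith [hlt j hj]
          · linarith
          · exact (hgt j hj).le
      intro j j' hj
      refine (hle j').trans ?_
      induction j using Fin.lastCases with
      | last => rw [valueD_last]; linarith [h.of_last_pos hj]
      | cast j =>
        rcases lt_trichotomy j k with hj' | rfl | hj'
        · rw [h.right_zero j hj'] at hj
          exact absurd hj (lt_irrefl _)
        · linarith [h.of_right_pos hj]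
        · exact (hgt j hj').ge
    · have hstart : G.valueD α k.castSucc = V := by
        rw [valueD_castSucc, hk, sum_Ici_last]
      intro j j' hj
      have key : ∀ M, V ≤ M → 0 ≤ M → G.valueD α j' ≤ M := fun M hM hM' => by
        induction j' using Fin.lastCases with
        | last => rwa [valueD_last]
        | cast j' =>
          rcases (show j' ≤ k from hk ▸ Fin.le_last j').lt_or_eq with hj' | rfl
          · linarith [hlt j' hj']
          · linarith
      induction j using Fin.lastCases with
      | last =>
        have := h.of_last_pos hj
        rw [valueD_last]
        exact key 0 (by linarith) le_rfl
      | cast j =>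
        rcases (show j ≤ k from hk ▸ Fin.le_last j).lt_or_eq with hj' | rfl
        · rw [h.right_zero j hj'] at hj
          exact absurd hj (lt_irrefl _)
        · have := h.of_right_pos hj
          rw [hk] at this
          exact key _ hstart.ge (by linarith)

/-- The start is the least reward in the attacker's support. Its positivity is kept, since the
structure alone does not determine the start. -/
theorem IsNash.exists_isEquilibriumFrom {G : ReducedGame m}
    {α : Fin (m + 1) → ℝ} {β : Fin (m + 2) → ℝ}
    (hcd : 0 < G.cd) (hw : ∀ i, 0 < G.weight i) (h : G.IsNash α β) :
    ∃ k, 0 < α k ∧ G.IsEquilibriumFrom k α β := by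
  rw [G.isNash_iff hcd] at h
  obtain ⟨hα, hβ, hA, hD⟩ := h
  obtain ⟨i₀, hi₀⟩ : ∃ i, 0 < α i := by
    by_contra! hcon
    have := sum_nonpos fun i (_ : i ∈ univ) => hcon i
    rw [hα.2] at this
    linarith
  have hne : ({i | 0 < α i} : Finset (Fin (m + 1))).Nonempty := ⟨i₀, by simpa using hi₀⟩
  set k := ({i | 0 < α i} : Finset (Fin (m + 1))).min' hne with hk
  have hkpos : 0 < α k := by simpa using Finset.min'_mem _ hne
  have hzero : ∀ i < k, α i = 0 := fun i hi => by
    by_contra hne'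
    exact absurd (Finset.min'_le _ i (by simpa using lt_of_le_of_ne (hα.1 i) (Ne.symm hne')))
      (not_le.2 hi)
  clear_value k
  have hDprev : ∀ i, 0 < i → G.valueD α (prev i).castSucc =
      α (prev i) - G.weight (prev i) + G.valueD α i.castSucc := fun i hi => by
    rw [valueD_castSucc, valueD_castSucc, sum_Ici_prev _ hi]
  have hAprev : ∀ i, 0 < i → G.valueA β i = G.valueA β (prev i)
      + (G.r i - G.r (prev i)) - G.cd * β i.castSucc := fun i hi => by
    rw [valueA, valueA, sum_Iic_eq_add_prev _ hi]
    ring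
  -- Raising the threshold past a reward that is never chosen misses no attack and saves its false
  -- alarm weight.
  have hβzero : ∀ i, 0 < i → α (prev i) = 0 → β (prev i).castSucc = 0 := fun i hi h0 => by
    by_contra hne'
    have := hD (prev i).castSucc i.castSucc (lt_of_le_of_ne (hβ.1 _) (Ne.symm hne'))
    rw [hDprev i hi, h0] at this
    linarith [hw (prev i)]
  have hβlow : ∀ i < k, β i.castSucc = 0 := fun i hi => by
    obtain ⟨j, rfl, hj⟩ := exists_eq_prev (hi.trans_le (Fin.le_last k))
    exact hβzero j ((Fin.zero_le _).trans_lt hj) (hzero _ hi)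
  -- A first unused threshold above `k` would make reward `i` strictly better than its predecessor,
  -- which is then unused; this contradicts either `α k > 0` or the induction hypothesis.
  have hβpos : ∀ i, k < i → 0 < β i.castSucc := fun i => by
    induction i using WellFoundedLT.induction with
    | ind i ih =>
      intro hi
      have h0 : 0 < i := (Fin.zero_le k).trans_lt hi
      by_contra hcon
      have hb : β i.castSucc = 0 := le_antisymm (not_lt.1 hcon) (hβ.1 _)
      have ha : α (prev i) = 0 := by
        by_contra hne'
        have := hA (prev i) i (lt_of_le_of_ne (hα.1 _) (Ne.symm hne'))
        rw [hAprev i h0, hb] at this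
        linarith [G.r_strictMono (prev_lt h0)]
      rcases (le_prev hi).eq_or_lt with h1 | h1
      · rw [← h1] at ha
        exact hkpos.ne' ha
      · exact (ih _ (prev_lt h0) h1).ne' (hβzero i h0 ha)
  -- Thresholds `i` and `i + 1` are both used, hence equally good, and their values differ by α_i -
  -- w_i.
  have hmid : ∀ i, k < i → i < Fin.last m → α i = G.weight i := fun i hi hi' => by
    obtain ⟨j, rfl, hj⟩ := exists_eq_prev hi'
    have h1 := hD _ j.castSucc (hβpos _ hi)
    have h2 := hD _ (prev j).castSucc (hβpos j (hi.trans hj))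
    have h3 := hDprev j ((Fin.zero_le _).trans_lt hj)
    linarith
  have hDlast : G.valueD α (Fin.last m).castSucc = α (Fin.last m) - G.weight (Fin.last m) := by
    rw [valueD_castSucc, sum_Ici_last]
  have hlast : k < Fin.last m → G.weight (Fin.last m) ≤ α (Fin.last m) := fun hk' => by
    have := hD _ (Fin.last (m + 1)) (hβpos _ hk')
    rw [hDlast, valueD_last] at this
    linarith
  have hαpos : ∀ i, k ≤ i → 0 < α i := fun i hi => by
    rcases hi.eq_or_lt with rfl | hi
    · exact hkpos
    · rcases (Fin.le_last i).lt_or_eq with h1 | h1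
      · rw [hmid i hi h1]; exact hw i
      · subst h1
        exact (hw _).trans_le (hlast hi)
  have hstart : k < Fin.last m → G.valueD α k.castSucc =
      α k - G.weight k + (α (Fin.last m) - G.weight (Fin.last m)) := fun hk' => by
    rw [valueD_castSucc, G.sum_Ici_start hmid hk']
  refine ⟨k, hkpos, hα, hβ, hzero, hβlow, fun i hi => ?_, hmid, fun h0 => ?_, fun hk' => ?_,
    hlast, fun hpos => ?_, fun hpos => ?_⟩
  · have h0 : 0 < i := (Fin.zero_le k).trans_lt hi
    have h1 := hA i (prev i) (hαpos i (le_of_lt hi))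
    have h2 := hA (prev i) i (hαpos _ (le_prev hi))
    have h3 := hAprev i h0
    rw [gap_eq, eq_div_iff hcd.ne']
    linarith
  · have h1 := hA k (prev k) hkpos
    have h3 := hAprev k h0
    rw [gap_eq, le_div_iff₀ hcd]
    linarith
  · have h1 := hD _ k.castSucc (hβpos _ hk')
    rw [hDlast, hstart hk'] at h1
    linarith
  · rcases (Fin.le_last k).lt_or_eq with hk' | hk'
    · have h1 := hD _ (Fin.last m).castSucc hpos
      rw [hDlast, hstart hk'] at h1
      linarith
    · subst hk'
      have h1 := hD _ (Fin.last (m + 1)) hpos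
      rw [hDlast, valueD_last] at h1
      linarith
  · have h1 := hD _ (Fin.last m).castSucc hpos
    rw [hDlast, valueD_last] at h1
    linarith

/-! ### The form of the equilibria -/

theorem remainder_eq_of_mem {k : Fin (m + 1)} {β : Fin (m + 2) → ℝ}
    (h0 : ∀ i < k, β i.castSucc = 0) (hg : ∀ i > k, β i.castSucc = G.gap i)
    (h1 : ∑ j, β j = 1) : β k.castSucc + β (Fin.last (m + 1)) = G.remainder k := by
  have := G.right_add_last h0 hg
  linarith

theorem sum_Ioo_add {k : Fin (m + 1)} (hk : k < Fin.last m) (f : Fin (m + 1) → ℝ) :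
    ∑ i ∈ Ici k, f i = f k + ∑ i ∈ Ioo k (Fin.last m), f i + f (Fin.last m) := by
  have : Ioi k = insert (Fin.last m) (Ioo k (Fin.last m)) := by
    rw [Finset.Ioo_insert_right hk]
    ext; simp [Fin.le_last]
  rw [sum_Ici_eq_add_Ioi, this, sum_insert (by simp)]
  ring

/-- The same start works except when β_k fills its whole gap with the last classifier unused and α
is not full at both ends; that case is the third form with start `prev k`. -/
theorem IsEquilibriumFrom.exists_hasForm {G : ReducedGame m} {k : Fin (m + 1)}
    {α : Fin (m + 1) → ℝ} {β : Fin (m + 2) → ℝ} (hw : ∀ i, 0 < G.weight i)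
    (hk0 : 0 < α k) (h : G.IsEquilibriumFrom k α β) : ∃ k, G.HasForm k α β := by
  have hβk := h.mem_right.1 k.castSucc
  have hβl := h.mem_right.1 (Fin.last (m + 1))
  have hαl := h.mem_left.1 (Fin.last m)
  have basic : ∀ P : Prop, P → ((∀ i < k, β i.castSucc = 0) ∧ (∀ i < k, α i = 0) ∧
      (∀ i > k, β i.castSucc = G.gap i) ∧
      (∀ i, k < i → i < Fin.last m → α i = G.weight i) ∧
      0 ≤ β k.castSucc ∧ 0 ≤ β (Fin.last (m + 1)) ∧ 0 ≤ α k ∧ 0 ≤ α (Fin.last m) ∧ P) :=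
    fun P hP => ⟨h.right_zero, h.left_zero, h.right_gap, h.left_weight, hβk, hβl, hk0.le, hαl, hP⟩
  have hαk : k < Fin.last m → 0 < β k.castSucc → α k = G.weight k := fun hk' hb =>
    le_antisymm (h.left_le hk') (h.of_right_pos hb)
  have hαlast : k < Fin.last m → 0 < β (Fin.last (m + 1)) →
      α (Fin.last m) = G.weight (Fin.last m) := fun hk' hb =>
    le_antisymm (h.of_last_pos hb) (h.le_left hk')
  have hαlpos : 0 < α (Fin.last m) := by
    rcases (Fin.le_last k).lt_or_eq with hk' | hk'
    · exact (hw _).trans_le (h.le_left hk')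
    · rwa [← hk']
  rcases hβl.eq_or_lt with hl | hl
  · rcases hβk.eq_or_lt with hb | hb
    · refine ⟨k, basic _ (Or.inr (Or.inr (Or.inl ⟨hb.symm, hl.symm, hk0.le, ?_, hαl⟩)))⟩
      rcases (Fin.le_last k).lt_or_eq with hk' | hk'
      · refine le_min (h.left_le hk') ?_
        have h1 := sum_Ioo_add hk' α
        rw [sum_Ici_of_left_zero h.left_zero, h.mem_left.2] at h1
        linarith
      · have h1 := G.remainder_eq_of_mem h.right_zero h.right_gap h.mem_right.2
        rw [← hb, ← hl, hk', remainder_last] at h1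
        norm_num at h1
    · by_cases hg : 0 < k → β k.castSucc < G.gap k
      · exact ⟨k, basic _ (Or.inl ⟨hb, hg, hl.symm, fun hk' => hαk hk' hb, hαlpos⟩)⟩
      · push Not at hg
        obtain ⟨h0, hg⟩ := hg
        have hg' := le_antisymm (h.right_le h0) hg
        have hp := prev_lt h0
        by_cases hex : α k = G.weight k ∧ α (Fin.last m) = G.weight (Fin.last m)
        · exact ⟨k, basic _ (Or.inr (Or.inr (Or.inr ⟨hβk, h.right_le, hβl, hex.1, hex.2⟩)))⟩
        -- With β_k equal to the gap, `k` joins the indices above the start, and the entries of both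
        -- players at `prev k` vanish.
        · refine ⟨prev k, fun i hi => h.right_zero i (hi.trans hp),
            fun i hi => h.left_zero i (hi.trans hp), fun i hi => ?_, fun i hi hi' => ?_,
            (h.right_zero _ hp).ge, hβl, (h.left_zero _ hp).ge, hαl,
            Or.inr (Or.inr (Or.inl ⟨h.right_zero _ hp, hl.symm, (h.left_zero _ hp).ge, ?_, hαl⟩))⟩
          · rcases ((prev_lt_iff h0).1 hi).eq_or_lt with rfl | h'
            · exact hg'
            · exact h.right_gap i h'
          · rcases ((prev_lt_iff h0).1 hi).eq_or_lt with rfl | h'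
            · exact hαk hi' hb
            · exact h.left_weight i h' hi'
          · rw [h.left_zero _ hp]
            refine le_min (hw _).le ?_
            have h1 := sum_Ioo_add (hp.trans_le (Fin.le_last k)) α
            rw [sum_Ici_of_left_zero fun i hi => h.left_zero i (hi.trans hp), h.mem_left.2,
              h.left_zero _ hp] at h1
            linarith
  · by_cases hex : α k = G.weight k ∧ α (Fin.last m) = G.weight (Fin.last m)
    · exact ⟨k, basic _ (Or.inr (Or.inr (Or.inr ⟨hβk, h.right_le, hβl, hex.1, hex.2⟩)))⟩
    · have hlt : α k < G.weight k := by
        refine lt_of_le_of_ne ?_ fun he => hex ⟨he, ?_⟩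
        · rcases (Fin.le_last k).lt_or_eq with hk' | hk'
          · exact h.left_le hk'
          · rw [hk']; exact h.of_last_pos hl
        · rcases (Fin.le_last k).lt_or_eq with hk' | hk'
          · exact hαlast hk' hl
          · rwa [← hk']
      refine ⟨k, basic _ (Or.inr (Or.inl ⟨?_, hl, hk0, hlt, fun hk' => hαlast hk' hl⟩))⟩
      by_contra hne
      exact absurd (h.of_right_pos (lt_of_le_of_ne hβk (Ne.symm hne))) (not_le.2 hlt)

/-! ### The candidate strategies of the defender -/

/-- Weight `0` below `k`, `x` at `k`, `gap i` above `k`, and `y` on the last classifier. -/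
def betaMix (k : Fin (m + 1)) (x y : ℝ) : Fin (m + 2) → ℝ :=
  fun j => Fin.lastCases (motive := fun _ => ℝ) y
      (fun i => if i < k then 0 else if i = k then x else G.gap i) j

theorem computeBeta_one (s : Fin (m + 1)) :
    G.computeBeta s .one = G.betaMix s (G.remainder s) 0 := rfl

theorem computeBeta_two (s : Fin (m + 1)) :
    G.computeBeta s .two = G.betaMix s 0 (G.remainder s) := rfl

@[simp] theorem betaMix_last (k : Fin (m + 1)) (x y : ℝ) :
    G.betaMix k x y (Fin.last (m + 1)) = y := by simp [betaMix]

theorem betaMix_castSucc (k : Fin (m + 1)) (x y : ℝ) (i : Fin (m + 1)) :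
    G.betaMix k x y i.castSucc = if i < k then 0 else if i = k then x else G.gap i := by
  simp [betaMix]

@[simp] theorem betaMix_self (k : Fin (m + 1)) (x y : ℝ) :
    G.betaMix k x y k.castSucc = x := by simp [betaMix_castSucc]

theorem betaMix_of_lt {k i : Fin (m + 1)} (h : i < k) (x y : ℝ) :
    G.betaMix k x y i.castSucc = 0 := by simp [betaMix_castSucc, h]

theorem betaMix_of_gt {k i : Fin (m + 1)} (h : k < i) (x y : ℝ) :
    G.betaMix k x y i.castSucc = G.gap i := by simp [betaMix_castSucc, h.not_gt, h.ne']

theorem eq_betaMix {k : Fin (m + 1)} {β : Fin (m + 2) → ℝ}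
    (h0 : ∀ i < k, β i.castSucc = 0) (hg : ∀ i > k, β i.castSucc = G.gap i) :
    β = G.betaMix k (β k.castSucc) (β (Fin.last (m + 1))) := by
  funext j
  induction j using Fin.lastCases with
  | last => simp
  | cast j =>
    rcases lt_trichotomy j k with h | rfl | h
    · rw [h0 j h, G.betaMix_of_lt h]
    · simp
    · rw [hg j h, G.betaMix_of_gt h]

/-- One vector has two descriptions, a full gap at `k` or start `prev k` with nothing there. Thus
adjacent second candidates are the endpoints of a family with a single start. -/
theorem betaMix_prev {k : Fin (m + 1)} (hk : 0 < k) (y : ℝ) :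
    G.betaMix (prev k) 0 y = G.betaMix k (G.gap k) y := by
  have h1 := G.eq_betaMix (k := k) (β := G.betaMix (prev k) 0 y) (fun i hi => ?_)
    (fun i hi => G.betaMix_of_gt ((prev_lt hk).trans hi) _ _)
  · rwa [G.betaMix_of_gt (prev_lt hk), betaMix_last] at h1
  · rcases (le_prev hi).eq_or_lt with rfl | h
    · simp
    · exact G.betaMix_of_lt h _ _

theorem betaMix_combo (k : Fin (m + 1)) (x y x' y' : ℝ) {a b : ℝ} (hab : a + b = 1) :
    a • G.betaMix k x y + b • G.betaMix k x' y' =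
      G.betaMix k (a * x + b * x') (a * y + b * y') := by
  have h1 := G.eq_betaMix (k := k) (β := a • G.betaMix k x y + b • G.betaMix k x' y')
    (fun i hi => ?_) (fun i hi => ?_)
  · simpa using h1
  · simp [G.betaMix_of_lt hi]
  · simp [G.betaMix_of_gt hi, ← add_mul, hab]

theorem mem_segment_betaMix {k : Fin (m + 1)} {X R : ℝ} (hX : 0 ≤ X) {β : Fin (m + 2) → ℝ} :
    β ∈ segment ℝ (G.betaMix k X (R - X)) (G.betaMix k 0 R) ↔
      ∃ x, 0 ≤ x ∧ x ≤ X ∧ β = G.betaMix k x (R - x) := by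
  constructor
  · rintro ⟨a, b, ha, hb, hab, rfl⟩
    refine ⟨a * X, mul_nonneg ha hX, mul_le_of_le_one_left hX (by linarith), ?_⟩
    rw [G.betaMix_combo k _ _ _ _ hab]
    congr 1
    · ring
    · linear_combination R * hab
  · rintro ⟨x, hx, hxX, rfl⟩
    -- The coefficient `x / X` needs `X ≠ 0`; for `X = 0` the segment is a point.
    rcases hX.eq_or_lt with rfl | hX'
    · obtain rfl : x = 0 := le_antisymm hxX hx
      rw [sub_zero, segment_same]
      rfl
    · refine ⟨x / X, 1 - x / X, by positivity, ?_, by ring, ?_⟩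
      · rw [sub_nonneg, div_le_one hX']
        exact hxX
      · rw [G.betaMix_combo k _ _ _ _ (by ring)]
        congr 1
        · field_simp
          ring
        · field_simp
          ring

theorem betaMix_mem_stdSimplex (hcd : 0 < G.cd) {k : Fin (m + 1)} {x y : ℝ} :
    G.betaMix k x y ∈ stdSimplex ℝ (Fin (m + 2)) ↔ 0 ≤ x ∧ 0 ≤ y ∧ x + y = G.remainder k := by
  have hsum := G.right_add_last (k := k) (β := G.betaMix k x y)
    (fun i hi => G.betaMix_of_lt hi _ _) (fun i hi => G.betaMix_of_gt hi _ _)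
  rw [betaMix_self, betaMix_last] at hsum
  constructor
  · intro h
    refine ⟨by simpa using h.1 k.castSucc, by simpa using h.1 (Fin.last (m + 1)), ?_⟩
    rw [h.2] at hsum
    linarith
  · rintro ⟨hx, hy, hxy⟩
    refine ⟨fun j => ?_, by linarith⟩
    induction j using Fin.lastCases with
    | last => simpa
    | cast j =>
      rcases lt_trichotomy j k with h | rfl | h
      · rw [G.betaMix_of_lt h]
      · simpa
      · rw [G.betaMix_of_gt h]
        exact (G.gap_pos hcd ((Fin.zero_le k).trans_lt h)).le

theorem computeBeta_mem_stdSimplex (hcd : 0 < G.cd) (s : Fin (m + 1)) (t : CandidateType) :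
    G.computeBeta s t ∈ stdSimplex ℝ (Fin (m + 2)) ↔ 0 ≤ G.remainder s := by
  cases t
  · rw [computeBeta_one, G.betaMix_mem_stdSimplex hcd]
    simp
  · rw [computeBeta_two, G.betaMix_mem_stdSimplex hcd]
    simp

/-! ### The guarantees of the candidates -/

theorem mu_castSucc (hcd : 0 < G.cd) (i : Fin (m + 1)) :
    G.mu i.castSucc = G.cd * G.tailWeight i := by
  rw [mu, tailWeight, mul_sum, mul_sum]
  refine sum_congr ?_ fun j _ => (G.cd_mul_weight hcd j).symm
  ext; simp

theorem mu_last : G.mu (Fin.last (m + 1)) = 0 := by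
  simp [mu]

theorem guarantee_eq (hcd : 0 < G.cd) (ε : ℝ) {β : Fin (m + 2) → ℝ}
    (hβ : β ∈ stdSimplex ℝ (Fin (m + 2))) :
    G.guarantee ε β =
      univ.inf' univ_nonempty (fun i => G.r (Fin.last m) + ε - G.valueA β i)
        - G.cd * ∑ i, G.tailWeight i * β i.castSucc := by
  rw [guarantee, Fin.sum_univ_castSucc, mu_last, zero_mul, add_zero, mul_sum]
  congr 1
  · congr 1
    funext i
    rw [valueA, ← G.sum_detect_mul]
    simp only [Matrix.mulVec, dotProduct, costMatrix]
    calc ∑ j, (G.cd * G.detect j i - G.r i + (G.r (Fin.last m) + ε)) * β j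
        = ∑ j, (G.cd * (G.detect j i * β j) + (G.r (Fin.last m) + ε - G.r i) * β j) :=
          sum_congr rfl fun j _ => by ring
      _ = _ := by
        rw [sum_add_distrib, ← mul_sum, ← mul_sum, hβ.2]
        ring
  · exact sum_congr rfl fun i _ => by rw [G.mu_castSucc hcd]; ring

/-- The normalized value of the second candidate. -/
def potential (s : Fin (m + 1)) : ℝ := ∑ i ∈ Ioi s, G.gap i * (1 - G.tailWeight i)

theorem sum_tailWeight_mul_betaMix (k : Fin (m + 1)) (x y : ℝ) :
    ∑ i, G.tailWeight i * G.betaMix k x y i.castSucc =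
      G.tailWeight k * x + (1 - G.remainder k) - G.potential k := by
  have h1 : ∑ i, G.tailWeight i * G.betaMix k x y i.castSucc =
      ∑ i ∈ Ici k, G.tailWeight i * G.betaMix k x y i.castSucc :=
    (sum_Ici_of_left_zero fun i hi => by rw [G.betaMix_of_lt hi, mul_zero]).symm
  have h2 : ∑ i ∈ Ioi k, G.tailWeight i * G.betaMix k x y i.castSucc =
      ∑ i ∈ Ioi k, (G.gap i - G.gap i * (1 - G.tailWeight i)) :=
    sum_congr rfl fun i hi => by
      rw [G.betaMix_of_gt (by simpa using hi)]
      ring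
  rw [h1, sum_Ici_eq_add_Ioi, h2, sum_sub_distrib, betaMix_self, potential, remainder]
  ring

theorem r_last_sub (i : Fin (m + 1)) (hcd : 0 < G.cd) :
    G.r (Fin.last m) - G.r i = G.cd * (1 - G.remainder i) := by
  rw [remainder_eq]
  field_simp
  ring

theorem valueA_betaMix_of_ge (hcd : 0 < G.cd) {k i : Fin (m + 1)} (h : k ≤ i) (x y : ℝ) :
    G.valueA (G.betaMix k x y) i = G.r k - G.cd * x := by
  rw [valueA, G.sum_Iic_right (fun i hi => G.betaMix_of_lt hi _ _)
    (fun i hi => G.betaMix_of_gt hi _ _) h, betaMix_self]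
  field_simp
  ring

theorem valueA_betaMix_of_lt {k i : Fin (m + 1)} (h : i < k) (x y : ℝ) :
    G.valueA (G.betaMix k x y) i = G.r i := by
  rw [valueA, sum_eq_zero fun j hj => G.betaMix_of_lt ((mem_Iic.1 hj).trans_lt h) x y]
  ring

/-- The attacker's best value is r_s, attained from `s` on, because lower rewards go undetected but
are smaller. Then r_n - r_s = c_d (1 - ρ_s) cancels against the false alarm term. -/
theorem guarantee_two (hcd : 0 < G.cd) (ε : ℝ) {s : Fin (m + 1)} (hs : 0 ≤ G.remainder s) :
    G.guarantee ε (G.computeBeta s .two) = ε + G.cd * G.potential s := by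
  rw [G.guarantee_eq hcd ε ((G.computeBeta_mem_stdSimplex hcd s _).2 hs), computeBeta_two,
    sum_tailWeight_mul_betaMix]
  have : univ.inf' univ_nonempty
      (fun i => G.r (Fin.last m) + ε - G.valueA (G.betaMix s 0 (G.remainder s)) i) =
      G.r (Fin.last m) + ε - G.r s := by
    refine le_antisymm ((inf'_le _ (mem_univ s)).trans ?_) (le_inf' _ _ fun i _ => ?_)
    · rw [G.valueA_betaMix_of_ge hcd le_rfl]
      linarith
    · rcases lt_or_ge i s with h | h
      · rw [G.valueA_betaMix_of_lt h]
        linarith [G.r_strictMono h]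
      · rw [G.valueA_betaMix_of_ge hcd h]
        linarith
  rw [this]
  linear_combination G.r_last_sub s hcd

/-- From `s` on the attacker gets r_n - c_d. A negative remainder at `i` says exactly that r_i < r_n
- c_d, so undetected lower rewards are worse. -/
theorem guarantee_one (hcd : 0 < G.cd) (ε : ℝ) {s : Fin (m + 1)} (hs : 0 ≤ G.remainder s)
    (hmin : ∀ i < s, G.remainder i < 0) :
    G.guarantee ε (G.computeBeta s .one) =
      ε + G.cd * G.potential s + G.cd * (G.remainder s * (1 - G.tailWeight s)) := by
  rw [G.guarantee_eq hcd ε ((G.computeBeta_mem_stdSimplex hcd s _).2 hs), computeBeta_one,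
    sum_tailWeight_mul_betaMix]
  have hr := G.r_last_sub s hcd
  have : univ.inf' univ_nonempty
      (fun i => G.r (Fin.last m) + ε - G.valueA (G.betaMix s (G.remainder s) 0) i) =
      ε + G.cd := by
    refine le_antisymm ((inf'_le _ (mem_univ s)).trans ?_) (le_inf' _ _ fun i _ => ?_)
    · rw [G.valueA_betaMix_of_ge hcd le_rfl]
      linarith
    · rcases lt_or_ge i s with h | h
      · rw [G.valueA_betaMix_of_lt h]
        have h1 := G.r_last_sub i hcd
        have h2 := mul_pos hcd (neg_pos.2 (hmin i h))
        linarith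
      · rw [G.valueA_betaMix_of_ge hcd h]
        linarith
  rw [this]
  ring

theorem potential_prev {s : Fin (m + 1)} (hs : 0 < s) :
    G.potential (prev s) = G.gap s * (1 - G.tailWeight s) + G.potential s := by
  rw [potential, Ioi_prev hs, sum_Ici_eq_add_Ioi, potential]

/-- At a start beyond the first admissible one, the undetected reward just below `s` is a good reply
for the attacker; evaluating the minimum there gives the bound. -/
theorem guarantee_one_le (hcd : 0 < G.cd) (ε : ℝ) {s : Fin (m + 1)} (hs : 0 ≤ G.remainder s)
    (h0 : 0 < s) :
    G.guarantee ε (G.computeBeta s .one) ≤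
      ε + G.cd * G.potential (prev s) - G.cd * (G.remainder (prev s) * G.tailWeight s) := by
  rw [G.guarantee_eq hcd ε ((G.computeBeta_mem_stdSimplex hcd s _).2 hs), computeBeta_one,
    sum_tailWeight_mul_betaMix]
  have h1 := inf'_le (s := univ)
    (fun i => G.r (Fin.last m) + ε - G.valueA (G.betaMix s (G.remainder s) 0) i)
    (mem_univ (prev s))
  rw [G.valueA_betaMix_of_lt (prev_lt h0)] at h1
  have h2 := G.r_last_sub (prev s) hcd
  rw [potential_prev _ h0, remainder_prev]
  rw [remainder_prev] at h2
  linarith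

theorem potential_sub {s t : Fin (m + 1)} (h : s ≤ t) :
    G.potential s - G.potential t = ∑ i ∈ Ioc s t, G.gap i * (1 - G.tailWeight i) := by
  have : Ioi s = Ioc s t ∪ Ioi t := by
    ext i
    simp only [mem_Ioi, mem_union, mem_Ioc]
    constructor
    · intro hi
      exact (le_or_gt i t).imp (fun h' => ⟨hi, h'⟩) id
    · rintro (hi | hi)
      · exact hi.1
      · exact h.trans_lt hi
  have hd : Disjoint (Ioc s t) (Ioi t) := by
    rw [Finset.disjoint_left]
    intro i hi hi'
    simp only [mem_Ioc, mem_Ioi] at hi hi'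
    exact hi'.not_ge hi.2
  rw [potential, potential, this, sum_union hd]
  ring

theorem potential_lt_of_lt_one (hcd : 0 < G.cd) {s t : Fin (m + 1)} (h : s < t)
    (hW : ∀ i, s < i → i ≤ t → G.tailWeight i < 1) : G.potential t < G.potential s := by
  rw [← sub_pos, G.potential_sub h.le]
  refine sum_pos (fun i hi => ?_) ⟨t, by simpa using h⟩
  rw [mem_Ioc] at hi
  exact mul_pos (G.gap_pos hcd ((Fin.zero_le s).trans_lt hi.1)) (sub_pos.2 (hW i hi.1 hi.2))

theorem potential_lt_of_one_lt (hcd : 0 < G.cd) {s t : Fin (m + 1)} (h : s < t)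
    (hW : ∀ i, s < i → i ≤ t → 1 < G.tailWeight i) : G.potential s < G.potential t := by
  rw [← sub_neg, G.potential_sub h.le]
  refine sum_neg (fun i hi => ?_) ⟨t, by simpa using h⟩
  rw [mem_Ioc] at hi
  exact mul_neg_of_pos_of_neg (G.gap_pos hcd ((Fin.zero_le s).trans_lt hi.1))
    (sub_neg.2 (hW i hi.1 hi.2))

/-! ### The best indices -/

/-- `a` is the first index with nonnegative remainder, and `k` the last optimal starting
index. -/
structure IsPivot (a k : Fin (m + 1)) : Prop where
  nonneg : 0 ≤ G.remainder a
  neg_of_lt : ∀ i < a, G.remainder i < 0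
  le : a ≤ k
  eq_or : k = a ∨ 1 ≤ G.tailWeight k
  lt_one : ∀ i > k, G.tailWeight i < 1

/-- The last index has remainder 1, so `a` exists. `k` is the largest element of a set that contains
`a`. -/
theorem exists_isPivot : ∃ a k, G.IsPivot a k := by
  have hne : ({i | 0 ≤ G.remainder i} : Finset (Fin (m + 1))).Nonempty :=
    ⟨Fin.last m, by simp [remainder_last]⟩
  set a := ({i | 0 ≤ G.remainder i} : Finset (Fin (m + 1))).min' hne with ha
  have ha0 : 0 ≤ G.remainder a := by simpa using Finset.min'_mem _ hne
  have ha1 : ∀ i < a, G.remainder i < 0 := fun i hi => by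
    by_contra! hcon
    exact absurd (Finset.min'_le _ i (by simpa using hcon)) (not_le.2 hi)
  clear_value a
  have hne' : ({i | i = a ∨ a ≤ i ∧ 1 ≤ G.tailWeight i} : Finset (Fin (m + 1))).Nonempty :=
    ⟨a, by simp⟩
  have hmem := Finset.max'_mem _ hne'
  refine ⟨a, ({i | i = a ∨ a ≤ i ∧ 1 ≤ G.tailWeight i} : Finset (Fin (m + 1))).max' hne',
    ha0, ha1, ?_, ?_, fun i hi => ?_⟩
  · rcases (mem_filter.1 hmem).2 with h | h
    · exact h.ge
    · exact h.1
  · rcases (mem_filter.1 hmem).2 with h | h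
    · exact Or.inl h
    · exact Or.inr h.2
  · by_contra! hcon
    have h1 : a ≤ i := by
      refine le_trans ?_ (le_of_lt hi)
      rcases (mem_filter.1 hmem).2 with h | h
      · exact h.ge
      · exact h.1
    exact absurd (Finset.le_max' _ i (by simp [h1, hcon])) (not_le.2 hi)

namespace IsPivot

variable {G} {a k : Fin (m + 1)} (h : G.IsPivot a k) (hcd : 0 < G.cd)
  (hw : ∀ i, 0 < G.weight i)
include h hcd

theorem nonneg_iff (s : Fin (m + 1)) : 0 ≤ G.remainder s ↔ a ≤ s := by
  constructor
  · intro hs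
    by_contra! hcon
    exact absurd (h.neg_of_lt s hcon) (not_lt.2 hs)
  · exact fun hs => h.nonneg.trans ((G.remainder_strictMono hcd).monotone hs)

theorem mem_bestIndices_iff (ε : ℝ) (t : CandidateType) (s : Fin (m + 1)) :
    s ∈ G.bestIndices ε t ↔ a ≤ s ∧ ∀ s', a ≤ s' →
      G.guarantee ε (G.computeBeta s' t) ≤ G.guarantee ε (G.computeBeta s t) := by
  simp only [bestIndices, Set.mem_ofPred_eq, G.computeBeta_mem_stdSimplex hcd,
    h.nonneg_iff hcd]

theorem guarantee_two {s : Fin (m + 1)} (ε : ℝ) (hs : a ≤ s) :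
    G.guarantee ε (G.computeBeta s .two) = ε + G.cd * G.potential s :=
  G.guarantee_two hcd ε ((h.nonneg_iff hcd s).2 hs)

theorem guarantee_one (ε : ℝ) : G.guarantee ε (G.computeBeta a .one) =
    ε + G.cd * G.potential a + G.cd * (G.remainder a * (1 - G.tailWeight a)) :=
  G.guarantee_one hcd ε h.nonneg h.neg_of_lt

theorem nonempty_bestIndices (ε : ℝ) (t : CandidateType) : (G.bestIndices ε t).Nonempty := by
  obtain ⟨s, hs, hmax⟩ := (Ici a).exists_max_image
    (fun s => G.guarantee ε (G.computeBeta s t)) ⟨a, by simp⟩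
  exact ⟨s, (h.mem_bestIndices_iff hcd ε t s).2 ⟨by simpa using hs, fun s' hs' =>
    hmax s' (by simpa using hs')⟩⟩

include hw

/-- The potential drops by Δ_s (1 - W_s) from `prev s` to `s`. This is negative while W_s > 1 and
positive once W_s < 1, so the maximum is at `k`; only W_k = 1 makes a step flat. -/
theorem potential_lt_or {s : Fin (m + 1)} (hs : a ≤ s) :
    G.potential s < G.potential k ∨ s = k ∨
      (0 < k ∧ s = prev k ∧ G.tailWeight k = 1 ∧ G.potential s = G.potential k) := by
  rcases lt_trichotomy s k with hlt | rfl | hgt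
  · have h0 : 0 < k := (Fin.zero_le s).trans_lt hlt
    have hk : 1 ≤ G.tailWeight k := h.eq_or.resolve_left (hs.trans_lt hlt).ne'
    have h1 := G.potential_prev h0
    have h2 : G.gap k * (1 - G.tailWeight k) ≤ 0 :=
      mul_nonpos_of_nonneg_of_nonpos (G.gap_pos hcd h0).le (by linarith)
    rcases (le_prev hlt).eq_or_lt with rfl | hlt'
    · rcases hk.eq_or_lt with hk | hk
      · refine Or.inr (Or.inr ⟨h0, rfl, hk.symm, ?_⟩)
        rw [h1, ← hk]
        ring
      · have h3 : G.gap k * (1 - G.tailWeight k) < 0 :=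
          mul_neg_of_pos_of_neg (G.gap_pos hcd h0) (by linarith)
        exact Or.inl (by linarith)
    · have h3 := G.potential_lt_of_one_lt hcd hlt' fun i _ hi =>
        hk.trans_lt (G.tailWeight_strictAnti hw (hi.trans_lt (prev_lt h0)))
      exact Or.inl (by linarith)
  · exact Or.inr (Or.inl rfl)
  · exact Or.inl (G.potential_lt_of_lt_one hcd hgt fun i hi _ => h.lt_one i hi)

theorem potential_le {s : Fin (m + 1)} (hs : a ≤ s) : G.potential s ≤ G.potential k := by
  rcases h.potential_lt_or hcd hw hs with h' | rfl | h'
  · exact h'.le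
  · exact le_rfl
  · exact h'.2.2.2.le

theorem mem_bestIndices_two_iff (ε : ℝ) (s : Fin (m + 1)) :
    s ∈ G.bestIndices ε .two ↔ a ≤ s ∧ (s = k ∨ 0 < k ∧ s = prev k ∧ G.tailWeight k = 1) := by
  rw [h.mem_bestIndices_iff hcd]
  refine and_congr_right fun hs => ?_
  rw [h.guarantee_two hcd ε hs]
  constructor
  · intro hmax
    have h1 := hmax k h.le
    rw [h.guarantee_two hcd ε h.le, add_le_add_iff_left, mul_le_mul_iff_right₀ hcd] at h1
    rcases h.potential_lt_or hcd hw hs with h' | h' | h'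
    · exact absurd h' (not_lt.2 h1)
    · exact Or.inl h'
    · exact Or.inr ⟨h'.1, h'.2.1, h'.2.2.1⟩
  · intro hor s' hs'
    rw [h.guarantee_two hcd ε hs', add_le_add_iff_left, mul_le_mul_iff_right₀ hcd]
    refine (h.potential_le hcd hw hs').trans ?_
    rcases hor with rfl | ⟨h0, rfl, hk⟩
    · exact le_rfl
    · rw [G.potential_prev h0, hk]
      simp

theorem guarantee_two_of_mem {ε : ℝ} {s : Fin (m + 1)} (hs : s ∈ G.bestIndices ε .two) :
    G.guarantee ε (G.computeBeta s .two) = ε + G.cd * G.potential k := by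
  have h1 := (h.mem_bestIndices_iff hcd ε .two s).1 hs
  have h2 := h1.2 k h.le
  rw [h.guarantee_two hcd ε h1.1, h.guarantee_two hcd ε h.le] at *
  have := mul_le_mul_of_nonneg_left (h.potential_le hcd hw h1.1) hcd.le
  linarith

theorem self_mem_bestIndices_two (ε : ℝ) : k ∈ G.bestIndices ε .two :=
  (h.mem_bestIndices_two_iff hcd hw ε k).2 ⟨h.le, Or.inl rfl⟩

theorem bestIndices_two_eq_singleton (ε : ℝ) (hk : k = a ∨ G.tailWeight k ≠ 1) :
    G.bestIndices ε .two = {k} := by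
  ext s
  rw [h.mem_bestIndices_two_iff hcd hw, Set.mem_singleton_iff]
  constructor
  · rintro ⟨hs, rfl | ⟨h0, rfl, h1⟩⟩
    · rfl
    · rcases hk with rfl | hk
      · exact absurd (prev_lt h0) (not_lt.2 hs)
      · exact absurd h1 hk
  · rintro rfl
    exact ⟨h.le, Or.inl rfl⟩

/-- Past the first admissible index, the first candidates are no better than the second ones. -/
theorem guarantee_one_lt_or (ε : ℝ) {s : Fin (m + 1)} (hs : a < s) :
    G.guarantee ε (G.computeBeta s .one) ≤ ε + G.cd * G.potential k ∧
    (G.guarantee ε (G.computeBeta s .one) = ε + G.cd * G.potential k →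
      prev s = a ∧ G.remainder a = 0 ∧ G.potential a = G.potential k) := by
  have h0 : 0 < s := (Fin.zero_le a).trans_lt hs
  have hp := le_prev hs
  have hW : 0 < G.tailWeight s :=
    sum_pos (fun i _ => hw i) ⟨s, by simp⟩
  have h1 := G.guarantee_one_le hcd ε ((h.nonneg_iff hcd s).2 hs.le) h0
  have h2 : 0 ≤ G.remainder (prev s) := (h.nonneg_iff hcd _).2 hp
  have h3 := mul_nonneg hcd.le (mul_nonneg h2 hW.le)
  have h4 := mul_le_mul_of_nonneg_left (h.potential_le hcd hw hp) hcd.le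
  refine ⟨by linarith, fun he => ?_⟩
  -- The bound falls short of the second value by c_d ρ_{s-1} W_s, so equality kills the remainder.
  have h5 : G.remainder (prev s) = 0 := by
    by_contra hne
    have := mul_pos hcd (mul_pos (lt_of_le_of_ne h2 (Ne.symm hne)) hW)
    linarith
  have h6 : prev s = a := by
    rcases hp.eq_or_lt with h' | h'
    · exact h'.symm
    · have := G.remainder_strictMono hcd h'
      linarith [h.nonneg]
  rw [h6] at h4 h5 h1
  exact ⟨h6, h5, mul_left_cancel₀ hcd.ne' (by rw [h6] at h3; linarith)⟩

/-! ### The returned profiles -/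

theorem algorithmOutput_of_first_better (ε : ℝ) (hka : k = a) (hr : 0 < G.remainder a)
    (hW : G.tailWeight a < 1) :
    G.algorithmOutput ε = G.outputs {G.computeBeta a .one} a := by
  subst hka
  have hgt : ε + G.cd * G.potential k < G.guarantee ε (G.computeBeta k .one) := by
    rw [h.guarantee_one hcd]
    have := mul_pos hcd (mul_pos hr (sub_pos.2 hW))
    linarith
  have hbest : ∀ s, s ∈ G.bestIndices ε .one ↔ s = k := fun s => by
    rw [h.mem_bestIndices_iff hcd]
    constructor
    · rintro ⟨hs, hmax⟩
      rcases hs.eq_or_lt with h' | h'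
      · exact h'.symm
      · have h1 := (h.guarantee_one_lt_or hcd hw ε h').1
        have h2 := hmax k le_rfl
        linarith
    · rintro rfl
      refine ⟨le_rfl, fun s' hs' => ?_⟩
      rcases hs'.eq_or_lt with rfl | h'
      · exact le_rfl
      · linarith [(h.guarantee_one_lt_or hcd hw ε h').1]
  ext x
  constructor
  · rintro ⟨s₁, h₁, s₂, h₂, hx⟩
    rw [hbest] at h₁
    subst h₁
    simp only [h.guarantee_two_of_mem hcd hw h₂] at hx
    rcases hx with hx | hx | hx
    · exact hx.2
    · exact absurd hx.1 hgt.not_gt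
    · exact absurd hx.1 hgt.ne'
  · intro hx
    have h₂ := h.self_mem_bestIndices_two hcd hw ε
    refine ⟨k, (hbest k).2 rfl, k, h₂, Or.inl ⟨?_, hx⟩⟩
    rw [h.guarantee_two_of_mem hcd hw h₂]
    exact hgt

theorem mem_algorithmOutput_of_tie (ε : ℝ) (hka : k = a)
    (hr : G.remainder a = 0 ∨ G.tailWeight a = 1) (x) :
    x ∈ G.algorithmOutput ε ↔
      (G.computeBeta a .one ≠ G.computeBeta a .two ∧
        x ∈ G.outputs (segment ℝ (G.computeBeta a .one) (G.computeBeta a .two)) a) ∨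
      (G.computeBeta a .one = G.computeBeta a .two ∧
        x ∈ G.outputs {G.computeBeta a .one} a) := by
  subst hka
  have heq : G.guarantee ε (G.computeBeta k .one) = ε + G.cd * G.potential k := by
    rw [h.guarantee_one hcd]
    rcases hr with hr | hr <;> simp [hr]
  have hmem : k ∈ G.bestIndices ε .one := by
    rw [h.mem_bestIndices_iff hcd]
    refine ⟨le_rfl, fun s' hs' => ?_⟩
    rcases hs'.eq_or_lt with rfl | h'
    · exact le_rfl
    · rw [heq]
      exact (h.guarantee_one_lt_or hcd hw ε h').1
  have hsing := h.bestIndices_two_eq_singleton hcd hw ε (Or.inl rfl)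
  have h₂ := h.self_mem_bestIndices_two hcd hw ε
  constructor
  · rintro ⟨s₁, h₁, s₂, h₂', hx⟩
    obtain rfl : s₂ = k := by rwa [hsing] at h₂'
    -- With zero remainder the next index can also be best of the first type. All best indices share
    -- one value, and the branch itself imposes `s₁ = s₂`.
    have hval : G.guarantee ε (G.computeBeta s₁ .one) = ε + G.cd * G.potential s₂ :=
      le_antisymm
        (by
          rw [← heq]
          exact ((h.mem_bestIndices_iff hcd ε .one s₂).1 hmem).2 s₁
            ((h.mem_bestIndices_iff hcd ε .one s₁).1 h₁).1)
        (by
          rw [← heq]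
          exact ((h.mem_bestIndices_iff hcd ε .one s₁).1 h₁).2 s₂ le_rfl)
    simp only [hval, h.guarantee_two_of_mem hcd hw h₂, gt_iff_lt, lt_irrefl, false_and,
      false_or, true_and] at hx
    rcases hx with ⟨-, rfl, hx⟩ | ⟨s₂', hs₂', hs, -⟩
    · exact hx
    · rw [hsing, Set.mem_singleton_iff] at hs₂'
      subst hs₂'
      omega
  · intro hx
    refine ⟨k, hmem, k, h₂, Or.inr (Or.inr ⟨?_, Or.inl ⟨hsing, rfl, hx⟩⟩)⟩
    rw [heq, h.guarantee_two_of_mem hcd hw h₂]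

theorem algorithmOutput_of_second_better (ε : ℝ) (hW : 1 < G.tailWeight k)
    (hr : a < k ∨ 0 < G.remainder a) :
    G.algorithmOutput ε = G.outputs {G.computeBeta k .two} k := by
  have hsing := h.bestIndices_two_eq_singleton hcd hw ε (Or.inr hW.ne')
  have h₂ := h.self_mem_bestIndices_two hcd hw ε
  have hak : a < k → G.potential a < G.potential k := fun hlt => by
    rcases h.potential_lt_or hcd hw le_rfl with h' | h' | h'
    · exact h'
    · exact absurd h' hlt.ne
    · exact absurd h'.2.2.1 hW.ne'
  have hlt : ∀ s, a ≤ s → G.guarantee ε (G.computeBeta s .one) < ε + G.cd * G.potential k :=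
    fun s hs => by
      rcases hs.eq_or_lt with rfl | h'
      · rw [h.guarantee_one hcd]
        have hWa : 1 < G.tailWeight a := hW.trans_le ((G.tailWeight_strictAnti hw).antitone h.le)
        have hle := mul_le_mul_of_nonneg_left (h.potential_le hcd hw le_rfl) hcd.le
        have hle' := mul_nonneg hcd.le (mul_nonneg h.nonneg (sub_nonneg.2 hWa.le))
        rcases hr with hr | hr
        · have := mul_lt_mul_of_pos_left (hak hr) hcd
          linarith
        · have := mul_pos hcd (mul_pos hr (sub_pos.2 hWa))
          linarith
      · have h1 := h.guarantee_one_lt_or hcd hw ε h'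
        refine lt_of_le_of_ne h1.1 fun he => ?_
        obtain ⟨-, h3, h4⟩ := h1.2 he
        rcases hr with hr | hr
        · exact (hak hr).ne h4
        · exact hr.ne' h3
  ext x
  constructor
  · rintro ⟨s₁, h₁, s₂, h₂', hx⟩
    obtain rfl : s₂ = k := by rwa [hsing] at h₂'
    have hval := hlt s₁ ((h.mem_bestIndices_iff hcd ε .one s₁).1 h₁).1
    simp only [h.guarantee_two_of_mem hcd hw h₂] at hx
    rcases hx with hx | ⟨-, hx⟩ | hx
    · exact absurd hx.1 hval.not_gt
    · rcases hx with ⟨-, hx⟩ | ⟨s₂', hs₂', hs, -⟩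
      · exact hx
      · rw [hsing, Set.mem_singleton_iff] at hs₂'
        subst hs₂'
        omega
    · exact absurd hx.1 hval.ne
  · intro hx
    obtain ⟨s₁, h₁⟩ := h.nonempty_bestIndices hcd ε .one
    refine ⟨s₁, h₁, k, h₂, Or.inr (Or.inl ⟨?_, Or.inl ⟨hsing, hx⟩⟩)⟩
    rw [h.guarantee_two_of_mem hcd hw h₂]
    exact hlt s₁ ((h.mem_bestIndices_iff hcd ε .one s₁).1 h₁).1

theorem algorithmOutput_of_two_best (ε : ℝ) (hW : G.tailWeight k = 1) (hlt : a < k) :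
    G.algorithmOutput ε =
      G.outputs (segment ℝ (G.computeBeta (prev k) .two) (G.computeBeta k .two)) k := by
  have h0 : 0 < k := (Fin.zero_le a).trans_lt hlt
  have hp := le_prev hlt
  have h₂ := h.self_mem_bestIndices_two hcd hw ε
  have h₂p : prev k ∈ G.bestIndices ε .two :=
    (h.mem_bestIndices_two_iff hcd hw ε _).2 ⟨hp, Or.inr ⟨h0, rfl, hW⟩⟩
  have hcons : ∀ s ∈ G.bestIndices ε .two, ∀ s' ∈ G.bestIndices ε .two, s'.val = s.val + 1 →
      s = prev k ∧ s' = k := fun s hs s' hs' hv => by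
    rw [h.mem_bestIndices_two_iff hcd hw] at hs hs'
    have hpv := val_prev_add_one h0
    rcases hs.2 with rfl | ⟨-, rfl, -⟩ <;> rcases hs'.2 with rfl | ⟨-, rfl, -⟩
    · omega
    · omega
    · exact ⟨rfl, rfl⟩
    · omega
  have hnot : ∀ s, G.bestIndices ε .two ≠ {s} := fun s hs => by
    rw [hs, Set.mem_singleton_iff] at h₂ h₂p
    exact (prev_lt h0).ne (h₂p.trans h₂.symm)
  -- The first type can at most tie, and a tie forces ρ_a = 0 and `prev k = a`. The two candidates
  -- at `prev k` then coincide, so both branches return the same set.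
  have hone : ∀ s, a ≤ s → G.guarantee ε (G.computeBeta s .one) ≤ ε + G.cd * G.potential k ∧
      (G.guarantee ε (G.computeBeta s .one) = ε + G.cd * G.potential k →
        G.computeBeta (prev k) .one = G.computeBeta (prev k) .two) := fun s hs => by
    have hfin : G.remainder a = 0 → G.potential a = G.potential k →
        G.computeBeta (prev k) .one = G.computeBeta (prev k) .two := fun hr hpot => by
      rcases h.potential_lt_or hcd hw le_rfl with h' | h' | h'
      · exact absurd hpot h'.ne
      · exact absurd h' hlt.ne
      · rw [← h'.2.1, computeBeta_one, computeBeta_two, hr]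
    rcases hs.eq_or_lt with rfl | h'
    · rw [h.guarantee_one hcd]
      have hWa : 1 < G.tailWeight a := hW ▸ G.tailWeight_strictAnti hw hlt
      have hle := mul_le_mul_of_nonneg_left (h.potential_le hcd hw le_rfl) hcd.le
      have hle' := mul_nonneg hcd.le (mul_nonneg h.nonneg (sub_nonneg.2 hWa.le))
      refine ⟨by linarith, fun he => hfin ?_ ?_⟩
      · by_contra hne
        have := mul_pos hcd (mul_pos (lt_of_le_of_ne h.nonneg (Ne.symm hne)) (sub_pos.2 hWa))
        linarith
      · exact mul_left_cancel₀ hcd.ne' (by linarith)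
    · have h1 := h.guarantee_one_lt_or hcd hw ε h'
      exact ⟨h1.1, fun he => hfin (h1.2 he).2.1 (h1.2 he).2.2⟩
  ext x
  constructor
  · rintro ⟨s₁, h₁, s₂, h₂', hx⟩
    have hval := hone s₁ ((h.mem_bestIndices_iff hcd ε .one s₁).1 h₁).1
    simp only [h.guarantee_two_of_mem hcd hw h₂'] at hx
    rcases hx with hx | ⟨-, hx⟩ | ⟨he, hx⟩
    · exact absurd hx.1 (not_lt.2 hval.1)
    · rcases hx with hx | ⟨s₂', hs₂', hs, hx⟩
      · exact absurd hx.1 (hnot _)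
      · obtain ⟨rfl, rfl⟩ := hcons _ h₂' _ hs₂' hs
        exact hx
    · rcases hx with hx | ⟨s₂', hs₂', hs, hx⟩
      · exact absurd hx.1 (hnot _)
      · obtain ⟨rfl, rfl⟩ := hcons _ h₂' _ hs₂' hs
        rwa [hval.2 he] at hx
  · intro hx
    obtain ⟨s₁, h₁⟩ := h.nonempty_bestIndices hcd ε .one
    have hval := hone s₁ ((h.mem_bestIndices_iff hcd ε .one s₁).1 h₁).1
    have hv := val_prev_add_one h0
    refine ⟨s₁, h₁, prev k, h₂p, ?_⟩
    simp only [h.guarantee_two_of_mem hcd hw h₂p]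
    rcases hval.1.eq_or_lt with he | he
    · refine Or.inr (Or.inr ⟨he, Or.inr ⟨k, h₂, hv, ?_⟩⟩)
      rwa [hval.2 he]
    · exact Or.inr (Or.inl ⟨he, Or.inr ⟨k, h₂, hv, hx⟩⟩)

end IsPivot

/-! ### The computed strategies of the attacker -/

theorem alphaFillLast_of_lt {k i : Fin (m + 1)} (h : i < k) (z : ℝ) :
    G.alphaFillLast k z i = 0 := by
  have h1 : i ≠ Fin.last m := (h.trans_le (Fin.le_last k)).ne
  simp [alphaFillLast, Function.update_of_ne h1, Function.update_of_ne h.ne, alphaBase, h]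

theorem alphaFillLast_self {k : Fin (m + 1)} (h : k < Fin.last m) (z : ℝ) :
    G.alphaFillLast k z k = z := by
  simp [alphaFillLast, Function.update_of_ne h.ne]

theorem alphaFillLast_of_gt {k i : Fin (m + 1)} (h : k < i) (h' : i < Fin.last m) (z : ℝ) :
    G.alphaFillLast k z i = G.weight i := by
  simp [alphaFillLast, Function.update_of_ne h'.ne, Function.update_of_ne h.ne', alphaBase,
    h.not_gt]

theorem sum_alphaFillLast (k : Fin (m + 1)) (z : ℝ) : ∑ i, G.alphaFillLast k z i = 1 := by
  rw [← sum_Ici_of_left_zero (k := k) fun i hi => G.alphaFillLast_of_lt hi z]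
  have : Ici k = insert (Fin.last m) (Ico k (Fin.last m)) := by
    rw [Finset.Ico_insert_right (Fin.le_last k)]
    ext; simp [Fin.le_last]
  rw [this, sum_insert (by simp)]
  simp only [alphaFillLast, Function.update_self]
  rw [sub_add_eq_add_sub, sub_eq_iff_eq_add, add_right_inj]
  refine sum_congr rfl fun i hi => ?_
  rw [Function.update_of_ne (mem_Ico.1 hi).2.ne]

/-- The entry at the last index is fixed by total mass, so only the entry at `k` is free. -/
theorem eq_of_left {k : Fin (m + 1)} {α α' : Fin (m + 1) → ℝ}
    (h0 : ∀ i < k, α i = 0) (h0' : ∀ i < k, α' i = 0)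
    (hw : ∀ i, k < i → i < Fin.last m → α i = G.weight i)
    (hw' : ∀ i, k < i → i < Fin.last m → α' i = G.weight i)
    (h1 : ∑ i, α i = 1) (h1' : ∑ i, α' i = 1) (hk : k < Fin.last m → α k = α' k) : α = α' := by
  have hlt : ∀ i < Fin.last m, α i = α' i := fun i hi => by
    rcases lt_trichotomy i k with h | rfl | h
    · rw [h0 i h, h0' i h]
    · exact hk hi
    · rw [hw i h hi, hw' i h hi]
  funext i
  rcases (Fin.le_last i).lt_or_eq with h | rfl
  · exact hlt i h
  · rw [← h1', Fin.sum_univ_castSucc, Fin.sum_univ_castSucc,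
      sum_congr rfl fun j _ => hlt j.castSucc (Fin.castSucc_lt_last j)] at h1
    exact add_left_cancel h1

theorem eq_alphaFillLast {k : Fin (m + 1)} {α : Fin (m + 1) → ℝ} {z : ℝ}
    (h0 : ∀ i < k, α i = 0) (hw : ∀ i, k < i → i < Fin.last m → α i = G.weight i)
    (h1 : ∑ i, α i = 1) (hk : k < Fin.last m → α k = z) : α = G.alphaFillLast k z :=
  G.eq_of_left h0 (fun _ hi => G.alphaFillLast_of_lt hi z) hw
    (fun _ hi hi' => G.alphaFillLast_of_gt hi hi' z) h1 (G.sum_alphaFillLast k z)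
    fun h => by rw [hk h, G.alphaFillLast_self h]

theorem alphaFillLast_last_eq_one (z : ℝ) :
    G.alphaFillLast (Fin.last m) z (Fin.last m) = 1 := by
  simp [alphaFillLast]

theorem alphaFillLast_last {k : Fin (m + 1)} (h : k < Fin.last m) (z : ℝ) :
    G.alphaFillLast k z (Fin.last m) =
      1 - G.tailWeight k + (G.weight k - z) + G.weight (Fin.last m) := by
  have := G.balance (fun _ hi => G.alphaFillLast_of_lt hi z) (G.sum_alphaFillLast k z)
    (fun _ hi hi' => G.alphaFillLast_of_gt hi hi' z) h
  rw [G.alphaFillLast_self h] at this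
  linarith

/-- Both assignment orders land in one family, so a single parameter describes all returned attacker
strategies. -/
theorem alphaFillFirst_eq (k : Fin (m + 1)) :
    G.alphaFillFirst k = G.alphaFillLast k (1 - G.tailWeight k + G.weight k) := by
  have hbase : Function.update (G.alphaBase k) (Fin.last m) (G.weight (Fin.last m)) =
      G.alphaBase k := by
    rw [Function.update_eq_self_iff]
    simp [alphaBase, (Fin.le_last k).not_gt]
  have hIoc : Ioc k (Fin.last m) = Ioi k := by ext; simp [Fin.le_last]
  have hsum : ∑ i ∈ Ioi k, G.alphaBase k i = G.tailWeight k - G.weight k := by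
    rw [tailWeight, sum_Ici_eq_add_Ioi, add_sub_cancel_left]
    refine sum_congr rfl fun i hi => ?_
    simp [alphaBase, (mem_Ioi.1 hi).not_gt]
  have hdef : G.alphaFillFirst k =
      Function.update (G.alphaBase k) k (1 - (G.tailWeight k - G.weight k)) := by
    simp only [alphaFillFirst, hbase, hIoc, hsum]
  have h0 : ∀ i < k, G.alphaFillFirst k i = 0 := fun i hi => by
    simp [hdef, Function.update_of_ne hi.ne, alphaBase, hi]
  refine G.eq_alphaFillLast h0 (fun i hi _ => ?_) ?_ (fun _ => ?_)
  · simp [hdef, Function.update_of_ne hi.ne', alphaBase, hi.not_gt]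
  · rw [← sum_Ici_of_left_zero h0, sum_Ici_eq_add_Ioi,
      sum_congr rfl fun i hi => show G.alphaFillFirst k i = G.alphaBase k i by
        rw [hdef, Function.update_of_ne (mem_Ioi.1 hi).ne'], hsum, hdef, Function.update_self]
    ring
  · rw [hdef, Function.update_self]
    ring

theorem alphaFillLast_combo (k : Fin (m + 1)) (z z' : ℝ) {a b : ℝ} (hab : a + b = 1) :
    a • G.alphaFillLast k z + b • G.alphaFillLast k z' =
      G.alphaFillLast k (a * z + b * z') := by
  refine G.eq_alphaFillLast (fun i hi => ?_) (fun i hi hi' => ?_) ?_ (fun hk => ?_)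
  · simp [G.alphaFillLast_of_lt hi]
  · simp [G.alphaFillLast_of_gt hi hi', ← add_mul, hab]
  · simp [sum_add_distrib, ← mul_sum, sum_alphaFillLast, hab]
  · simp [G.alphaFillLast_self hk]

theorem mem_segment_alphaFillLast {k : Fin (m + 1)} {M : ℝ} (hM : 0 ≤ M)
    {α : Fin (m + 1) → ℝ} :
    α ∈ segment ℝ (G.alphaFillLast k 0) (G.alphaFillLast k M) ↔
      ∃ z, 0 ≤ z ∧ z ≤ M ∧ α = G.alphaFillLast k z := by
  constructor
  · rintro ⟨a, b, ha, hb, hab, rfl⟩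
    refine ⟨b * M, mul_nonneg hb hM, mul_le_of_le_one_left hM (by linarith), ?_⟩
    rw [G.alphaFillLast_combo k _ _ hab, mul_zero, zero_add]
  · rintro ⟨z, hz, hzM, rfl⟩
    rcases hM.eq_or_lt with rfl | hM'
    · obtain rfl : z = 0 := le_antisymm hzM hz
      rw [segment_same]
      rfl
    · refine ⟨1 - z / M, z / M, ?_, by positivity, by ring, ?_⟩
      · rw [sub_nonneg, div_le_one hM']
        exact hzM
      · rw [G.alphaFillLast_combo k _ _ (by ring)]
        congr 1
        field_simp
        ring

theorem isEquilibriumFrom_alphaFillLast (hcd : 0 < G.cd) (hw : ∀ i, 0 < G.weight i)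
    {k : Fin (m + 1)} {x y z : ℝ} (hx : 0 ≤ x) (hy : 0 ≤ y) (hxy : x + y = G.remainder k)
    (hgap : 0 < k → x ≤ G.gap k)
    (hz : k < Fin.last m → 0 ≤ z ∧ z ≤ G.weight k ∧
      G.weight (Fin.last m) ≤ G.alphaFillLast k z (Fin.last m))
    (hx' : 0 < x → G.weight k ≤ G.alphaFillLast k z k)
    (hy' : 0 < y → G.alphaFillLast k z (Fin.last m) ≤ G.weight (Fin.last m)) :
    G.IsEquilibriumFrom k (G.alphaFillLast k z) (G.betaMix k x y) where
  mem_left := by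
    refine ⟨fun i => ?_, G.sum_alphaFillLast k z⟩
    rcases (Fin.le_last i).lt_or_eq with h | rfl
    · rcases lt_trichotomy i k with h' | rfl | h'
      · rw [G.alphaFillLast_of_lt h']
      · rw [G.alphaFillLast_self h]
        exact (hz h).1
      · rw [G.alphaFillLast_of_gt h' h]
        exact (hw i).le
    · rcases (Fin.le_last k).lt_or_eq with h | rfl
      · exact (hw _).le.trans (hz h).2.2
      · rw [alphaFillLast_last_eq_one]
        exact zero_le_one
  mem_right := (G.betaMix_mem_stdSimplex hcd).2 ⟨hx, hy, hxy⟩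
  left_zero _ hi := G.alphaFillLast_of_lt hi z
  right_zero _ hi := G.betaMix_of_lt hi x y
  right_gap _ hi := G.betaMix_of_gt hi x y
  left_weight _ hi hi' := G.alphaFillLast_of_gt hi hi' z
  right_le h0 := by rw [betaMix_self]; exact hgap h0
  left_le h := by rw [G.alphaFillLast_self h]; exact (hz h).2.1
  le_left h := (hz h).2.2
  of_right_pos h := hx' (by simpa using h)
  of_last_pos h := hy' (by simpa using h)

/-! ### The sets of returned profiles -/

theorem mem_outputs_of_pos {B : Set (Fin (m + 2) → ℝ)} {k : Fin (m + 1)}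
    (h : ∃ β ∈ B, 0 < β k.castSucc) (α : Fin (m + 1) → ℝ) (β : Fin (m + 2) → ℝ) :
    (α, β) ∈ G.outputs B k ↔ α = G.alphaFillLast k (G.weight k) ∧ β ∈ B := by
  rw [outputs, Set.mem_prod, computeAlpha, if_pos h, Set.mem_singleton_iff]

theorem mem_outputs_of_last_pos {k : Fin (m + 1)} {y : ℝ} (hy : 0 < y)
    (α : Fin (m + 1) → ℝ) (β : Fin (m + 2) → ℝ) :
    (α, β) ∈ G.outputs {G.betaMix k 0 y} k ↔
      α = G.alphaFillLast k (1 - G.tailWeight k + G.weight k) ∧ β = G.betaMix k 0 y := by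
  rw [outputs, Set.mem_prod, computeAlpha, if_neg (by simp), if_pos (by simpa using hy),
    Set.mem_singleton_iff, Set.mem_singleton_iff, alphaFillFirst_eq]

theorem mem_outputs_of_zero {k : Fin (m + 1)}
    (hM : 0 ≤ min (G.weight k) (1 - ∑ i ∈ Ioo k (Fin.last m), G.weight i))
    (α : Fin (m + 1) → ℝ) (β : Fin (m + 2) → ℝ) :
    (α, β) ∈ G.outputs {G.betaMix k 0 0} k ↔
      (∃ z, 0 ≤ z ∧ z ≤ min (G.weight k) (1 - ∑ i ∈ Ioo k (Fin.last m), G.weight i) ∧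
        α = G.alphaFillLast k z) ∧ β = G.betaMix k 0 0 := by
  rw [outputs, Set.mem_prod, computeAlpha, if_neg (by simp), if_neg (by simp),
    G.mem_segment_alphaFillLast hM, Set.mem_singleton_iff]

/-! ### Equilibria and the pivot -/

/-- Where the defender never plays the last classifier, the attacker's last weight is large. -/
theorem IsEquilibriumFrom.le_last {G : ReducedGame m} {k : Fin (m + 1)}
    {α : Fin (m + 1) → ℝ} {β : Fin (m + 2) → ℝ}
    (h : G.IsEquilibriumFrom k α β) (hl : β (Fin.last (m + 1)) = 0) :
    G.weight (Fin.last m) ≤ α (Fin.last m) := by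
  rcases (Fin.le_last k).lt_or_eq with hk | rfl
  · exact h.le_left hk
  · refine h.of_right_pos ?_
    have := G.remainder_eq_of_mem h.right_zero h.right_gap h.mem_right.2
    rw [hl, remainder_last] at this
    linarith

/-- By the balance and α_n ≥ w_n, 1 - W_k ≥ α_k - w_k. Positivity of α_k then makes the weight
strictly above `k` less than 1. -/
theorem IsEquilibriumFrom.tailWeight_lt_one {G : ReducedGame m} {k : Fin (m + 1)}
    {α : Fin (m + 1) → ℝ} {β : Fin (m + 2) → ℝ} (hw : ∀ i, 0 < G.weight i)
    (hk : 0 < α k) (h : G.IsEquilibriumFrom k α β) {i : Fin (m + 1)} (hi : k < i) :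
    G.tailWeight i < 1 := by
  have hk' := hi.trans_le (Fin.le_last i)
  have h1 := G.balance h.left_zero h.mem_left.2 h.left_weight hk'
  have h2 := h.le_left hk'
  have h3 : G.tailWeight k = G.weight k + ∑ j ∈ Ioi k, G.weight j := sum_Ici_eq_add_Ioi _ _
  have h4 : G.tailWeight i ≤ ∑ j ∈ Ioi k, G.weight j :=
    sum_le_sum_of_subset_of_nonneg
      (fun j hj => mem_Ioi.2 (hi.trans_le (mem_Ici.1 hj))) fun j _ _ => (hw j).le
  linarith

theorem IsEquilibriumFrom.one_le_tailWeight {G : ReducedGame m} {k : Fin (m + 1)}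
    {α : Fin (m + 1) → ℝ} {β : Fin (m + 2) → ℝ}
    (h : G.IsEquilibriumFrom k α β) (hl : 0 < β (Fin.last (m + 1))) :
    1 ≤ G.tailWeight k := by
  have h1 := h.of_last_pos hl
  rcases (Fin.le_last k).lt_or_eq with hk | rfl
  · have h2 := G.balance h.left_zero h.mem_left.2 h.left_weight hk
    linarith [h.left_le hk]
  · rw [tailWeight_last, ← left_last_eq_one h.left_zero h.mem_left.2]
    exact h1

theorem IsEquilibriumFrom.tailWeight_le_one {G : ReducedGame m} {k : Fin (m + 1)}
    {α : Fin (m + 1) → ℝ} {β : Fin (m + 2) → ℝ}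
    (h : G.IsEquilibriumFrom k α β) (hb : 0 < β k.castSucc) :
    G.tailWeight k ≤ 1 := by
  have h1 := h.of_right_pos hb
  rcases (Fin.le_last k).lt_or_eq with hk | rfl
  · have h2 := G.balance h.left_zero h.mem_left.2 h.left_weight hk
    linarith [h.le_left hk]
  · rw [tailWeight_last, ← left_last_eq_one h.left_zero h.mem_left.2]
    exact h1

theorem IsEquilibriumFrom.left_eq_weight {G : ReducedGame m} {k : Fin (m + 1)}
    {α : Fin (m + 1) → ℝ} {β : Fin (m + 2) → ℝ}
    (h : G.IsEquilibriumFrom k α β) (hb : 0 < β k.castSucc) :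
    α = G.alphaFillLast k (G.weight k) :=
  G.eq_alphaFillLast h.left_zero h.left_weight h.mem_left.2 fun hk =>
    le_antisymm (h.left_le hk) (h.of_right_pos hb)

theorem IsEquilibriumFrom.left_eq_of_last_pos {G : ReducedGame m} {k : Fin (m + 1)}
    {α : Fin (m + 1) → ℝ} {β : Fin (m + 2) → ℝ}
    (h : G.IsEquilibriumFrom k α β) (hl : 0 < β (Fin.last (m + 1))) :
    α = G.alphaFillLast k (1 - G.tailWeight k + G.weight k) :=
  G.eq_alphaFillLast h.left_zero h.left_weight h.mem_left.2 fun hk => by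
    have h1 := G.balance h.left_zero h.mem_left.2 h.left_weight hk
    linarith [h.le_left hk, h.of_last_pos hl]

theorem IsEquilibriumFrom.right_eq {G : ReducedGame m} {k : Fin (m + 1)}
    {α : Fin (m + 1) → ℝ} {β : Fin (m + 2) → ℝ} (h : G.IsEquilibriumFrom k α β) :
    β = G.betaMix k (β k.castSucc) (G.remainder k - β k.castSucc) := by
  rw [← G.remainder_eq_of_mem h.right_zero h.right_gap h.mem_right.2, add_sub_cancel_left]
  exact G.eq_betaMix h.right_zero h.right_gap

namespace IsPivot

variable {G} {a k : Fin (m + 1)}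

/-- The possible starting indices of an equilibrium. -/
theorem start_cases (h : G.IsPivot a k) (hcd : 0 < G.cd)
    (hw : ∀ i, 0 < G.weight i)
    {l : Fin (m + 1)} {α : Fin (m + 1) → ℝ} {β : Fin (m + 2) → ℝ} (hpos : 0 < α l)
    (he : G.IsEquilibriumFrom l α β) :
    (0 < β (Fin.last (m + 1)) ∧ l = k) ∨
    (β (Fin.last (m + 1)) = 0 ∧ l = a ∧ β l.castSucc = G.remainder a) ∨
    (β (Fin.last (m + 1)) = 0 ∧ 0 < l ∧ prev l = a ∧ G.remainder a = 0 ∧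
      β l.castSucc = G.gap l) := by
  have hxy := G.remainder_eq_of_mem he.right_zero he.right_gap he.mem_right.2
  have hx := he.mem_right.1 l.castSucc
  have hy := he.mem_right.1 (Fin.last (m + 1))
  have hal : a ≤ l := (h.nonneg_iff hcd l).1 (by linarith)
  rcases hy.eq_or_lt with hy | hy
  · right
    rw [← hy, add_zero] at hxy
    rcases hal.eq_or_lt with rfl | hlt
    · exact Or.inl ⟨hy.symm, rfl, hxy⟩
    · have h0 : 0 < l := (Fin.zero_le a).trans_lt hlt
      -- Here β_l = ρ_l is at most the gap, so the remainder at `prev l` is at most 0, while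
      -- admissibility makes it at least 0.
      have h1 := he.right_le h0
      have h2 : 0 ≤ G.remainder (prev l) := (h.nonneg_iff hcd _).2 (le_prev hlt)
      have h3 := G.remainder_prev l
      have h4 : prev l = a := by
        rcases (le_prev hlt).eq_or_lt with h' | h'
        · exact h'.symm
        · linarith [G.remainder_strictMono hcd h', h.nonneg]
      rw [h4] at h2 h3
      exact Or.inr ⟨hy.symm, h0, h4, by linarith, by linarith⟩
  · left
    refine ⟨hy, ?_⟩
    -- The start has tail weight at least 1 and all later indices have less, which among the indices
    -- from `a` on singles out `k`.
    have h1 := he.one_le_tailWeight hy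
    rcases lt_trichotomy l k with hlt | rfl | hgt
    · rcases h.eq_or with rfl | h2
      · exact absurd hal (not_le.2 hlt)
      · exact absurd h2 (not_le.2 (he.tailWeight_lt_one hw hpos hlt))
    · rfl
    · exact absurd h1 (not_le.2 (h.lt_one l hgt))

/-- The profiles with the attacker's weight at the starting index full. -/
theorem isNash_of_full (hcd : 0 < G.cd) (hw : ∀ i, 0 < G.weight i) {x : ℝ}
    (hx : 0 ≤ x) (hxr : x ≤ G.remainder k) (hgap : 0 < k → x ≤ G.gap k)
    (hW : 0 < x → G.tailWeight k ≤ 1) (hW' : x < G.remainder k → G.tailWeight k = 1)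
    (hr : 0 < G.remainder k) :
    G.IsNash (G.alphaFillLast k (G.weight k)) (G.betaMix k x (G.remainder k - x)) := by
  have hle : G.tailWeight k ≤ 1 := by
    rcases hxr.eq_or_lt with h | h
    · exact hW (by linarith)
    · exact (hW' h).le
  refine (G.isEquilibriumFrom_alphaFillLast hcd hw hx (sub_nonneg.2 hxr) (by ring) hgap
    (fun hk => ⟨(hw k).le, le_rfl, ?_⟩) (fun _ => ?_) (fun hy => ?_)).isNash hcd hw
  · rw [G.alphaFillLast_last hk]
    linarith
  · rcases (Fin.le_last k).lt_or_eq with hk | rfl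
    · rw [G.alphaFillLast_self hk]
    · rw [alphaFillLast_last_eq_one, ← tailWeight_last]
      exact hle
  · have h1 := hW' (by linarith)
    rcases (Fin.le_last k).lt_or_eq with hk | rfl
    · rw [G.alphaFillLast_last hk]
      linarith
    · rw [alphaFillLast_last_eq_one, ← tailWeight_last]
      exact h1.ge

theorem mem_iff_of_first_better (h : G.IsPivot a k) (hcd : 0 < G.cd)
    (hw : ∀ i, 0 < G.weight i) (ε : ℝ) (hka : k = a) (hr : 0 < G.remainder a)
    (hW : G.tailWeight a < 1) (α : Fin (m + 1) → ℝ) (β : Fin (m + 2) → ℝ) :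
    (α, β) ∈ G.algorithmOutput ε ↔ G.IsNash α β := by
  rw [h.algorithmOutput_of_first_better hcd hw ε hka hr hW, computeBeta_one,
    G.mem_outputs_of_pos ⟨_, Set.mem_singleton _, by simpa using hr⟩, Set.mem_singleton_iff]
  constructor
  · rintro ⟨rfl, rfl⟩
    have := isNash_of_full hcd hw (k := a) h.nonneg le_rfl (fun h0 => ?_) (fun _ => hW.le)
      (fun h' => absurd h' (lt_irrefl _)) hr
    · rwa [sub_self] at this
    · linarith [h.neg_of_lt _ (prev_lt h0), G.remainder_prev a]
  · intro hN
    obtain ⟨l, hpos, he⟩ := hN.exists_isEquilibriumFrom hcd hw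
    rcases h.start_cases hcd hw hpos he with ⟨hl, rfl⟩ | ⟨-, rfl, hx⟩ | ⟨-, -, -, h0, -⟩
    · subst hka
      exact absurd (he.one_le_tailWeight hl) (not_le.2 hW)
    · refine ⟨he.left_eq_weight (by rwa [hx]), ?_⟩
      rw [he.right_eq, hx, sub_self]
    · exact absurd h0 hr.ne'

theorem mem_iff_of_tie (h : G.IsPivot a k) (hcd : 0 < G.cd)
    (hw : ∀ i, 0 < G.weight i) (ε : ℝ) (hka : k = a) (hr : 0 < G.remainder a)
    (hW : G.tailWeight a = 1) (α : Fin (m + 1) → ℝ) (β : Fin (m + 2) → ℝ) :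
    (α, β) ∈ G.algorithmOutput ε ↔ G.IsNash α β := by
  have hne : G.computeBeta a .one ≠ G.computeBeta a .two := fun heq => by
    have := congrFun heq a.castSucc
    rw [computeBeta_one, computeBeta_two, betaMix_self, betaMix_self] at this
    exact hr.ne' this
  have hseg := G.mem_segment_betaMix (k := a) (R := G.remainder a) h.nonneg (β := β)
  rw [sub_self] at hseg
  simp only [h.mem_algorithmOutput_of_tie hcd hw ε hka (Or.inr hW), hne, ne_eq, not_false_eq_true,
    true_and, false_and, or_false]
  rw [computeBeta_one, computeBeta_two,
    G.mem_outputs_of_pos ⟨_, left_mem_segment ℝ _ _, by simpa using hr⟩, hseg]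
  have hgap : 0 < a → G.remainder a ≤ G.gap a := fun h0 => by
    linarith [h.neg_of_lt _ (prev_lt h0), G.remainder_prev a]
  constructor
  · rintro ⟨rfl, x, hx, hxr, rfl⟩
    exact isNash_of_full hcd hw hx hxr (fun h0 => hxr.trans (hgap h0)) (fun _ => hW.le)
      (fun _ => hW) hr
  · intro hN
    obtain ⟨l, hpos, he⟩ := hN.exists_isEquilibriumFrom hcd hw
    have hxy := G.remainder_eq_of_mem he.right_zero he.right_gap he.mem_right.2
    rcases h.start_cases hcd hw hpos he with ⟨hl, rfl⟩ | ⟨-, rfl, hx⟩ | ⟨-, -, -, h0, -⟩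
    · subst hka
      have hα := he.left_eq_of_last_pos hl
      rw [hW, sub_self, zero_add] at hα
      exact ⟨hα, _, he.mem_right.1 _, by linarith, he.right_eq⟩
    · exact ⟨he.left_eq_weight (by rwa [hx]), _, he.mem_right.1 _, hx.le, he.right_eq⟩
    · exact absurd h0 hr.ne'

theorem mem_iff_of_second_better (h : G.IsPivot a k) (hcd : 0 < G.cd)
    (hw : ∀ i, 0 < G.weight i) (ε : ℝ) (hW : 1 < G.tailWeight k)
    (hr : a < k ∨ 0 < G.remainder a) (α : Fin (m + 1) → ℝ) (β : Fin (m + 2) → ℝ) :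
    (α, β) ∈ G.algorithmOutput ε ↔ G.IsNash α β := by
  have hrk : 0 < G.remainder k := by
    rcases hr with hr | hr
    · exact h.nonneg.trans_lt (G.remainder_strictMono hcd hr)
    · exact hr.trans_le ((G.remainder_strictMono hcd).monotone h.le)
  rw [h.algorithmOutput_of_second_better hcd hw ε hW hr, computeBeta_two,
    G.mem_outputs_of_last_pos hrk]
  constructor
  · rintro ⟨rfl, rfl⟩
    refine (G.isEquilibriumFrom_alphaFillLast hcd hw le_rfl hrk.le (zero_add _)
      (fun h0 => (G.gap_pos hcd h0).le) (fun hk => ⟨?_, by linarith, ?_⟩)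
      (fun h' => absurd h' (lt_irrefl _)) (fun _ => ?_)).isNash hcd hw
    -- Nonnegativity of α_k amounts to tail weight at most 1 at the next index, which the pivot
    -- provides.
    · obtain ⟨t, rfl, ht⟩ := exists_eq_prev hk
      have h1 := sum_Ici_prev G.weight ((Fin.zero_le _).trans_lt ht)
      have h2 := h.lt_one t ht
      simp only [tailWeight] at h2 ⊢
      linarith
    · rw [G.alphaFillLast_last hk]
      linarith
    · rcases (Fin.le_last k).lt_or_eq with hk | rfl
      · rw [G.alphaFillLast_last hk]
        linarith
      · rw [alphaFillLast_last_eq_one, ← tailWeight_last]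
        exact hW.le
  · intro hN
    obtain ⟨l, hpos, he⟩ := hN.exists_isEquilibriumFrom hcd hw
    have hanti := (G.tailWeight_strictAnti hw).antitone
    rcases h.start_cases hcd hw hpos he with ⟨hl, rfl⟩ | ⟨-, rfl, hx⟩ | ⟨-, h0, hp, h0', hx⟩
    · have hx : β l.castSucc = 0 := by
        by_contra hne
        exact absurd (he.tailWeight_le_one
          (lt_of_le_of_ne (he.mem_right.1 _) (Ne.symm hne))) (not_le.2 hW)
      refine ⟨he.left_eq_of_last_pos hl, ?_⟩
      rw [he.right_eq, hx, sub_zero]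
    · exfalso
      rcases hr with hr | hr
      · exact absurd (he.tailWeight_lt_one hw hpos hr) hW.not_gt
      · have h1 := he.tailWeight_le_one (by rwa [hx])
        linarith [hanti h.le]
    · exfalso
      have hak : a < k := hr.resolve_right (by simp [h0'])
      have h1 := he.tailWeight_le_one (by rw [hx]; exact G.gap_pos hcd h0)
      rw [← hp, prev_lt_iff h0] at hak
      linarith [hanti hak]

theorem mem_iff_of_two_best (h : G.IsPivot a k) (hcd : 0 < G.cd)
    (hw : ∀ i, 0 < G.weight i) (ε : ℝ) (hW : G.tailWeight k = 1) (hlt : a < k)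
    (α : Fin (m + 1) → ℝ) (β : Fin (m + 2) → ℝ) :
    (α, β) ∈ G.algorithmOutput ε ↔ G.IsNash α β := by
  have h0 : 0 < k := (Fin.zero_le a).trans_lt hlt
  have hgap := G.gap_pos hcd h0
  have hrp : 0 ≤ G.remainder (prev k) := (h.nonneg_iff hcd _).2 (le_prev hlt)
  have hrk : 0 < G.remainder k := h.nonneg.trans_lt (G.remainder_strictMono hcd hlt)
  rw [remainder_prev] at hrp
  rw [h.algorithmOutput_of_two_best hcd hw ε hW hlt, computeBeta_two, computeBeta_two,
    G.betaMix_prev h0, remainder_prev,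
    G.mem_outputs_of_pos ⟨_, left_mem_segment ℝ _ _, by simpa using hgap⟩,
    G.mem_segment_betaMix hgap.le]
  constructor
  · rintro ⟨rfl, x, hx, hxg, rfl⟩
    exact isNash_of_full hcd hw hx (by linarith) (fun _ => hxg) (fun _ => hW.le)
      (fun _ => hW) hrk
  · intro hN
    obtain ⟨l, hpos, he⟩ := hN.exists_isEquilibriumFrom hcd hw
    rcases h.start_cases hcd hw hpos he with ⟨hl, rfl⟩ | ⟨-, rfl, -⟩ | ⟨-, h0', hp, -, hx⟩
    · have hα := he.left_eq_of_last_pos hl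
      rw [hW, sub_self, zero_add] at hα
      exact ⟨hα, _, he.mem_right.1 _, he.right_le h0, he.right_eq⟩
    · exact absurd hW (he.tailWeight_lt_one hw hpos hlt).ne
    · have hlk : l ≤ k := by
        rw [← prev_lt_iff h0', hp]
        exact hlt
      rcases hlk.eq_or_lt with rfl | hlk
      · exact ⟨he.left_eq_weight (by rwa [hx]), _, he.mem_right.1 _, hx.le, he.right_eq⟩
      · exact absurd hW (he.tailWeight_lt_one hw hpos hlk).ne

/-- The case where the two candidates at the first admissible index coincide. -/
theorem mem_iff_of_remainder_eq_zero (h : G.IsPivot a k) (hcd : 0 < G.cd)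
    (hw : ∀ i, 0 < G.weight i) (ε : ℝ) (hka : k = a) (hr : G.remainder a = 0)
    (α : Fin (m + 1) → ℝ) (β : Fin (m + 2) → ℝ) :
    (α, β) ∈ G.algorithmOutput ε ↔
      (∃ z, 0 ≤ z ∧ z ≤ min (G.weight a) (1 - ∑ i ∈ Ioo a (Fin.last m), G.weight i) ∧
        α = G.alphaFillLast a z) ∧ β = G.betaMix a 0 0 := by
  subst hka
  have hk : k < Fin.last m := by
    refine lt_of_le_of_ne (Fin.le_last k) fun hk => ?_
    rw [hk, remainder_last] at hr
    exact one_ne_zero hr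
  have heq : G.computeBeta k .one = G.computeBeta k .two := by
    rw [computeBeta_one, computeBeta_two, hr]
  simp only [h.mem_algorithmOutput_of_tie hcd hw ε rfl (Or.inl hr), heq, ne_eq, not_true_eq_false,
    true_and, false_and, false_or]
  rw [computeBeta_two, hr, G.mem_outputs_of_zero]
  refine le_min (hw k).le ?_
  obtain ⟨t, rfl, ht⟩ := exists_eq_prev hk
  have h1 := sum_Ici_prev G.weight ((Fin.zero_le _).trans_lt ht)
  have h2 := h.lt_one t ht
  have h3 := sum_Ioo_add hk G.weight
  rw [tailWeight] at h2
  linarith [hw (Fin.last m)]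

theorem mem_of_isNash_of_remainder_eq_zero (h : G.IsPivot a k) (hcd : 0 < G.cd)
    (hw : ∀ i, 0 < G.weight i) (ε : ℝ) (hka : k = a) (hr : G.remainder a = 0)
    {α : Fin (m + 1) → ℝ} {β : Fin (m + 2) → ℝ} (hN : G.IsNash α β) :
    (α, β) ∈ G.algorithmOutput ε := by
  rw [h.mem_iff_of_remainder_eq_zero hcd hw ε hka hr]
  subst hka
  have hk : k < Fin.last m := by
    refine lt_of_le_of_ne (Fin.le_last k) fun hk => ?_
    rw [hk, remainder_last] at hr
    exact one_ne_zero hr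
  have key : (∀ i < k, α i = 0) → (∀ i, k < i → i < Fin.last m → α i = G.weight i) →
      0 ≤ α k → α k ≤ G.weight k → 0 ≤ α (Fin.last m) → ∑ i, α i = 1 →
      ∃ z, 0 ≤ z ∧ z ≤ min (G.weight k) (1 - ∑ i ∈ Ioo k (Fin.last m), G.weight i) ∧
        α = G.alphaFillLast k z := fun h0 hmid hk0 hkw hl h1 => by
    refine ⟨α k, hk0, le_min hkw ?_, G.eq_alphaFillLast h0 hmid h1 fun _ => rfl⟩
    have h2 := sum_Ioo_add hk α
    rw [sum_Ici_of_left_zero h0, h1, sum_congr rfl fun i hi =>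
      hmid i (mem_Ioo.1 hi).1 (mem_Ioo.1 hi).2] at h2
    linarith
  obtain ⟨l, hpos, he⟩ := hN.exists_isEquilibriumFrom hcd hw
  have hl0 := he.mem_left.1 (Fin.last m)
  have hxy := G.remainder_eq_of_mem he.right_zero he.right_gap he.mem_right.2
  rcases h.start_cases hcd hw hpos he with ⟨hl, rfl⟩ | ⟨-, rfl, hx⟩ | ⟨hl, h0, rfl, -, hx⟩
  · linarith [he.mem_right.1 l.castSucc]
  · refine ⟨key he.left_zero he.left_weight hpos.le (he.left_le hk) hl0 he.mem_left.2, ?_⟩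
    rw [he.right_eq, hx, hr, sub_zero]
  -- An equilibrium starting just after the pivot fills the gap there, so it is also described from
  -- the pivot, with parameter 0.
  · have hp := prev_lt h0
    have hb : 0 < β l.castSucc := by rw [hx]; exact G.gap_pos hcd h0
    refine ⟨key (fun i hi => he.left_zero i (hi.trans hp)) (fun i hi hi' => ?_)
      (he.left_zero _ hp).ge ((he.left_zero _ hp).trans_le (hw _).le) hl0 he.mem_left.2, ?_⟩
    · rcases ((prev_lt_iff h0).1 hi).eq_or_lt with rfl | h'
      · exact le_antisymm (he.left_le hi') (he.of_right_pos hb)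
      · exact he.left_weight i h' hi'
    · rw [G.betaMix_prev h0, ← hx, ← hl]
      exact G.eq_betaMix he.right_zero he.right_gap

theorem isNash_of_mem_of_remainder_eq_zero (h : G.IsPivot a k) (hcd : 0 < G.cd)
    (hw : ∀ i, 0 < G.weight i) (ε : ℝ) (hka : k = a) (hr : G.remainder a = 0)
    {α : Fin (m + 1) → ℝ} {β : Fin (m + 2) → ℝ} (hmem : (α, β) ∈ G.algorithmOutput ε)
    (hl : G.weight (Fin.last m) ≤ α (Fin.last m)) : G.IsNash α β := by
  rw [h.mem_iff_of_remainder_eq_zero hcd hw ε hka hr] at hmem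
  obtain ⟨⟨z, hz, hzM, rfl⟩, rfl⟩ := hmem
  exact (G.isEquilibriumFrom_alphaFillLast hcd hw le_rfl le_rfl (by rw [hr, zero_add])
    (fun h0 => (G.gap_pos hcd h0).le) (fun _ => ⟨hz, hzM.trans (min_le_left _ _), hl⟩)
    (fun h' => absurd h' (lt_irrefl _)) (fun h' => absurd h' (lt_irrefl _))).isNash hcd hw

theorem le_last_of_mem_of_remainder_eq_zero (h : G.IsPivot a k) (hcd : 0 < G.cd)
    (hw : ∀ i, 0 < G.weight i) (ε : ℝ) (hka : k = a) (hr : G.remainder a = 0)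
    (hnd : ¬ ∃ k, G.r (Fin.last m) - G.r k = G.cd ∧
        ∑ i ∈ Finset.Ioi k, G.weight i < 1 ∧ 1 < ∑ i ∈ Finset.Ici k, G.weight i)
    {α : Fin (m + 1) → ℝ} {β : Fin (m + 2) → ℝ} (hmem : (α, β) ∈ G.algorithmOutput ε) :
    G.weight (Fin.last m) ≤ α (Fin.last m) := by
  rw [h.mem_iff_of_remainder_eq_zero hcd hw ε hka hr] at hmem
  obtain ⟨⟨z, hz, hzM, rfl⟩, -⟩ := hmem
  subst hka
  have hk : k < Fin.last m := by
    refine lt_of_le_of_ne (Fin.le_last k) fun hk => ?_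
    rw [hk, remainder_last] at hr
    exact one_ne_zero hr
  have hW : G.tailWeight k ≤ 1 := by
    by_contra! hcon
    -- Zero remainder means r_n - r_k = c_d, and the pivot property at the next index bounds the
    -- weight above `k`.
    refine hnd ⟨k, ?_, ?_, hcon⟩
    · rw [G.r_last_sub k hcd, hr]
      ring
    · obtain ⟨t, rfl, ht⟩ := exists_eq_prev hk
      rw [Ioi_prev ((Fin.zero_le _).trans_lt ht)]
      exact h.lt_one t ht
  rw [G.alphaFillLast_last hk]
  linarith [hzM.trans (min_le_left _ _)]

/-- Either the algorithm returns the equilibria exactly, or the two candidates at the first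
admissible index coincide and are optimal. -/
theorem mem_iff_or (h : G.IsPivot a k) (hcd : 0 < G.cd) (hw : ∀ i, 0 < G.weight i) (ε : ℝ) :
    (∀ α β, (α, β) ∈ G.algorithmOutput ε ↔ G.IsNash α β) ∨ (k = a ∧ G.remainder a = 0) := by
  rcases h.le.eq_or_lt with hka | hlt
  · rcases h.nonneg.eq_or_lt with hr | hr
    · exact Or.inr ⟨hka.symm, hr.symm⟩
    · left
      rcases lt_trichotomy (G.tailWeight a) 1 with hW | hW | hW
      · exact h.mem_iff_of_first_better hcd hw ε hka.symm hr hW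
      · exact h.mem_iff_of_tie hcd hw ε hka.symm hr hW
      · exact h.mem_iff_of_second_better hcd hw ε (hka ▸ hW) (Or.inr hr)
  · left
    rcases (h.eq_or.resolve_left hlt.ne').eq_or_lt with hW | hW
    · exact h.mem_iff_of_two_best hcd hw ε hW.symm hlt
    · exact h.mem_iff_of_second_better hcd hw ε hW (Or.inl hlt)

end IsPivot

end ReducedGame

end

/-! ### The main theorem -/

theorem theorem2 {m : ℕ} (G : ReducedGame m)
    (hp0 : 0 < G.p) (hp1 : G.p < 1) (hcd : 0 < G.cd) (hcfa : 0 < G.cfa)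
    (hP : ∀ i, 0 < G.P i) (ε : ℝ) (hε : 0 < ε) :
    -- the algorithm finds all Nash equilibria
    (∀ α β, G.IsNash α β → (α, β) ∈ G.algorithmOutput ε) ∧
    -- which of the returned profiles are equilibria
    (∀ α β, (α, β) ∈ G.algorithmOutput ε →
      (G.IsNash α β ↔
        (β (Fin.last (m + 1)) = 0 → G.weight (Fin.last m) ≤ α (Fin.last m)))) ∧
    -- outside one degenerate case the returned profiles are exactly the equilibria
    ((¬ ∃ k, G.r (Fin.last m) - G.r k = G.cd ∧
        ∑ i ∈ Finset.Ioi k, G.weight i < 1 ∧ 1 < ∑ i ∈ Finset.Ici k, G.weight i) →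
      G.algorithmOutput ε = {x | G.IsNash x.1 x.2}) ∧
    -- the form of the equilibria
    (∀ α β, G.IsNash α β → ∃ k, G.HasForm k α β) := by
  have hw := G.weight_pos hp0 hp1 hcd hcfa hP
  obtain ⟨a, k, h⟩ := G.exists_isPivot
  have hall : ∀ α β, G.IsNash α β → (α, β) ∈ G.algorithmOutput ε := fun α β hN => by
    rcases h.mem_iff_or hcd hw ε with hiff | ⟨hka, hr⟩
    · exact (hiff α β).2 hN
    · exact h.mem_of_isNash_of_remainder_eq_zero hcd hw ε hka hr hN
  refine ⟨hall, fun α β hmem => ⟨fun hN hl => ?_, fun hl => ?_⟩, fun hnd => ?_, fun α β hN => ?_⟩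
  · obtain ⟨l, -, he⟩ := hN.exists_isEquilibriumFrom hcd hw
    exact he.le_last hl
  · rcases h.mem_iff_or hcd hw ε with hiff | ⟨hka, hr⟩
    · exact (hiff α β).1 hmem
    · refine h.isNash_of_mem_of_remainder_eq_zero hcd hw ε hka hr hmem (hl ?_)
      rw [((h.mem_iff_of_remainder_eq_zero hcd hw ε hka hr α β).1 hmem).2,
        ReducedGame.betaMix_last]
  · ext ⟨α, β⟩
    refine ⟨fun hmem => ?_, hall α β⟩
    rcases h.mem_iff_or hcd hw ε with hiff | ⟨hka, hr⟩
    · exact (hiff α β).1 hmem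
    · exact h.isNash_of_mem_of_remainder_eq_zero hcd hw ε hka hr hmem
        (h.le_last_of_mem_of_remainder_eq_zero hcd hw ε hka hr hnd hmem)
  · obtain ⟨l, hpos, he⟩ := hN.exists_isEquilibriumFrom hcd hw
    exact he.exists_hasForm hw hpos
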